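/- Let $N_1,N_2\ge 1$ and let $u\in\mathbb{R}^{N_1}$, $v\in\mathbb{R}^{N_2}$ be vectors with strictly positive entries and $\sum_i u_i=\sum_j v_j$. The transportation polytope $\mathrm{TP}(u,v)$ is the set of all $y\in\mathbb{R}^{N_1\times N_2}$ with $y_{ij}\ge 0$ for all $i,j$, $\sum_j y_{ij}=u_i$ for all $i$, and $\sum_i y_{ij}=v_j$ for all $j$. A pair $(i,j)$ is critical if $y_{ij}>0$ for every $y\in \mathrm{TP}(u,v)$; let $\mu$ be the number of critical pairs. The polytope $\mathrm{TP}(u,v)$ is non-degenerate if each of its vertices has exactly $N_1+N_2-1$ positive entries. The combinatorial diameter of a polytope is the maximum distance between two of its vertices in its $1$-skeleton (the graph formed by its vertices and its one-dimensional faces). A polytope of dimension $d$ with $f$ facets (nonempty faces of dimension $d-1$) satisfies the Hirsch conjecture if its combinatorial diameter is at most the Hirsch bound $f-d$. Then: 1. The combinatorial diameter of $\mathrm{TP}(u,v)$ is at most $N_1+N_2-1-\mu$. 2. If $\mathrm{TP}(u,v)$ is non-degenerate, then $N_1+N_2-1-\mu$ is exactly its Hirsch bound $f-d$. 3. $\mathrm{TP}(u,v)$,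 degenerate or not, satisfies the Hirsch conjecture. 4. Every nonempty face $G$ of $\mathrm{TP}(u,v)$ satisfies the Hirsch conjecture (with the number of facets and the dimension of $G$), and the combinatorial diameter of $G$ is also at most $N_1+N_2-1-\mu$. In particular, any two vertices of $\mathrm{TP}(u,v)$ are joined by a walk of length at most $N_1+N_2-1-\mu$ in the $1$-skeleton of the minimal face containing both. -/

import Mathlib

/-! ### Faces, 1-skeleton, combinatorial diameter and the Hirsch bound of a convex polytope -/

section Polytope

variable {E : Type*} [AddCommGroup E] [Module ℝ E] [TopologicalSpace E]

/-- `F` is a nonempty face of `P`: the set of maximizers over `P` of a (continuous) linear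
functional. The functional `0` gives `P` itself as a face of `P`. -/
def IsPolytopeFace (P F : Set E) : Prop :=
  F.Nonempty ∧ IsExposed ℝ P F

/-- The dimension of a (nonempty) convex set: the dimension of its affine hull. -/
noncomputable def polyDim (P : Set E) : ℕ :=
  Module.finrank ℝ (vectorSpan ℝ P)

/-- The vertices of `P`: the points `x` such that `{x}` is a (zero-dimensional) face. -/
def polyVertices (P : Set E) : Set E :=
  {x | IsPolytopeFace P {x}}

/-- The facets of `P`: the nonempty faces of dimension `dim P - 1`. -/
def polyFacets (P : Set E) : Set (Set E) :=
  {F | IsPolytopeFace P F ∧ polyDim F + 1 = polyDim P}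

/-- The 1-skeleton (graph) of `P`: its nodes are the vertices of `P`, and two distinct vertices are
adjacent if they lie on a common one-dimensional face of `P`. -/
def polyGraph (P : Set E) : SimpleGraph (polyVertices P) where
  Adj x y := x ≠ y ∧ ∃ F : Set E, IsPolytopeFace P F ∧ polyDim F = 1 ∧ (x : E) ∈ F ∧ (y : E) ∈ F
  symm := ⟨fun _ _ h => ⟨h.1.symm, h.2.imp fun _ hF => ⟨hF.1, hF.2.1, hF.2.2.2, hF.2.2.1⟩⟩⟩
  loopless := ⟨fun _ h => h.1 rfl⟩

/-- The combinatorial diameter of `P` (the maximum graph distance between two vertices) is finite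
and at most `B`. The extended diameter `ediam` is `⊤` if the graph is disconnected. -/
def CombDiamLE (P : Set E) (B : ℤ) : Prop :=
  ∃ D : ℕ, (polyGraph P).ediam = (D : ℕ∞) ∧ (D : ℤ) ≤ B

/-- The Hirsch bound `f - d`, with `f` the number of facets and `d` the dimension. -/
noncomputable def hirschBound (P : Set E) : ℤ :=
  ((polyFacets P).ncard : ℤ) - (polyDim P : ℤ)

/-- `P` satisfies the Hirsch conjecture: its combinatorial diameter is at most `f - d`. -/
def SatisfiesHirsch (P : Set E) : Prop :=
  CombDiamLE P (hirschBound P)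

end Polytope

/-! ### Transportation polytopes -/

section Transportation

variable {N₁ N₂ : ℕ}

/-- The transportation polytope with margins `u` (supplies) and `v` (demands). -/
def transportationPolytope (u : Fin N₁ → ℝ) (v : Fin N₂ → ℝ) : Set (Fin N₁ → Fin N₂ → ℝ) :=
  {y | (∀ i, ∑ j, y i j = u i) ∧ (∀ j, ∑ i, y i j = v j) ∧ ∀ i j, 0 ≤ y i j}

/-- The critical pairs: the pairs (supply point, demand point) with strictly positive flow in every
feasible solution. -/
def criticalPairs (u : Fin N₁ → ℝ) (v : Fin N₂ → ℝ) : Set (Fin N₁ × Fin N₂) :=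
  {p | ∀ y ∈ transportationPolytope u v, 0 < y p.1 p.2}

/-- The transportation polytope is non-degenerate: each of its vertices has exactly
`N₁ + N₂ - 1` positive entries. -/
def IsNondegenerateTP (u : Fin N₁ → ℝ) (v : Fin N₂ → ℝ) : Prop :=
  ∀ y ∈ polyVertices (transportationPolytope u v),
    ({p : Fin N₁ × Fin N₂ | 0 < y p.1 p.2}.ncard : ℤ) = (N₁ : ℤ) + (N₂ : ℤ) - 1

end Transportation

/-! # Short walks on transportation polytopes and their faces

The nonempty faces of a transportation polytope are the polytopes `flowPoly B u v` of the flows with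
the given margins on an edge set `B` of the complete bipartite graph on supplies and demands
(`IsPolytopeFace.exists_flowPoly`). Let `E₀ ⊆ B` be a minimal set of edges whose inequalities
`0 ≤ y e` describe this polytope, and let `C` be a spanning forest of `B`. The facets correspond to
the edges in `E₀`, and the dimension is `|B \ C|`, so the Hirsch bound is `|C| - |B \ E₀|`
(`MinDescribes.hirschBound_eq_card`). A critical pair is an edge of `B` outside `E₀`, and `|C|` is
at most `N₁ + N₂ - 1`. Hence it is enough to join any two vertices by a walk of at most
`|C \ (B \ E₀)|` steps (`Describes.edist_le`).

The walk is a sequence of pivots from one spanning tree that carries a flow to another one, each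
inserting one edge of the spanning tree `S` of the target and deleting an edge. The point is that
the edges can be inserted in such an order that an inserted edge never has to be deleted again
(`WalkState`, `exists_pivotWalk`). Root `S` at a supply. An edge from a supply up to its parent
is inserted only after all children of this supply are *frozen*, that is, have their parent edge
inserted and no edges left that are not inserted. By conservation of flow, frozen parent edges then
carry at least their flow in the target, and inserted upward edges carry at most theirs. A frozen
parent edge therefore stays positive by itself. All other inserted edges are kept pointing towards a
common node `r`, and the next edge is inserted at `r`; so the flow on those of them that lie on the
cycle of the pivot increases, and none of them leaves the tree. Each edge of `S` is inserted at most
once, and edges of `S` that are positive in all flows need no pivot, for they are never absent.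

This argument requires a target that is positive on all of `S`. Flows take values in an
arbitrary ordered group there, and are applied with values in `ℝ ×ₗ ℝ`, where the second coordinate
is an infinitesimal perturbation. The redundant edges in `B \ E₀` have to be saved as well, although
they may carry no flow at some points: one unit of flow is added to each of them, and
since their inequalities follow from those in `E₀`, they are then positive in all flows
(`unperturb` reverses this). Finally, where `B` is not connected, bridges between its components are
added; they carry a constant infinitesimal flow and cost no pivots either.

In the nondegenerate case, a redundant edge that is not critical would be unused at some vertex, and
the circulation that raises the other unused edges and lowers this one would leave the polytope
while violating no inequality of `E₀` (`Describes.pos_of_notMem`). So exactly the critical pairs are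
redundant.
-/

/-! ### Cuts, spanning trees and exchanges in bipartite graphs -/

section Trees

variable {ι κ : Type*}

/-- The edge `e` of the complete bipartite graph on `ι ⊕ κ` joins the node set `A` to its
complement. -/
def Crosses (A : Set (ι ⊕ κ)) (e : ι × κ) : Prop :=
  ¬(Sum.inl e.1 ∈ A ↔ Sum.inr e.2 ∈ A)

/-- `A` is the tail side of `e` in `C`: it contains the supply end of `e`, but not the demand end,
and `e` is the only edge of `C` leaving `A`. -/
def IsCut (C : Finset (ι × κ)) (e : ι × κ) (A : Set (ι ⊕ κ)) : Prop :=
  Sum.inl e.1 ∈ A ∧ Sum.inr e.2 ∉ A ∧ ∀ e' ∈ C, e' ≠ e → ¬Crosses A e'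

/-- The edge set `C` contains no cycle, expressed by cuts: each of its edges is the only one
leaving some node set. -/
def Acyc (C : Finset (ι × κ)) : Prop :=
  ∀ e ∈ C, ∃ A, IsCut C e A

/-- The edge set `C` connects all nodes. -/
def Conn (C : Finset (ι × κ)) : Prop :=
  ∀ A : Set (ι ⊕ κ), (∀ e ∈ C, ¬Crosses A e) → ∀ p q, p ∈ A → q ∈ A

/-- `C` is the edge set of a spanning tree. -/
def IsSpanTree (C : Finset (ι × κ)) : Prop :=
  Acyc C ∧ Conn C

theorem crosses_compl {A : Set (ι ⊕ κ)} {e : ι × κ} : Crosses Aᶜ e ↔ Crosses A e := by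
  simp only [Crosses, Set.mem_compl_iff]; tauto

theorem crosses_symmDiff {A L : Set (ι ⊕ κ)} {e : ι × κ} :
    Crosses (symmDiff A L) e ↔ ¬(Crosses A e ↔ Crosses L e) := by
  simp only [Crosses, Set.mem_symmDiff]; tauto

theorem Conn.mono {C D : Finset (ι × κ)} (h : Conn C) (hCD : C ⊆ D) : Conn D :=
  fun A hA => h A fun e he => hA e (hCD he)

theorem Acyc.mono {C D : Finset (ι × κ)} (h : Acyc D) (hCD : C ⊆ D) : Acyc C := fun e he =>
  (h e (hCD he)).imp fun _ hA => ⟨hA.1, hA.2.1, fun e' he' => hA.2.2 e' (hCD he')⟩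

/-- A set left only by `e` is, up to complement, the tail side of `e`. -/
theorem exists_isCut {C : Finset (ι × κ)} {e : ι × κ} {A : Set (ι ⊕ κ)} (he : Crosses A e)
    (h : ∀ e' ∈ C, e' ≠ e → ¬Crosses A e') : IsCut C e A ∨ IsCut C e Aᶜ := by
  by_cases h1 : Sum.inl e.1 ∈ A
  · left; refine ⟨h1, ?_, h⟩; simp only [Crosses] at he; tauto
  · right; refine ⟨h1, ?_, fun e' he' hne => by rw [crosses_compl]; exact h e' he' hne⟩
    simp only [Crosses, Set.mem_compl_iff] at he ⊢; tauto

theorem acyc_of_crosses {C : Finset (ι × κ)}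
    (h : ∀ e ∈ C, ∃ A, Crosses A e ∧ ∀ e' ∈ C, e' ≠ e → ¬Crosses A e') : Acyc C := by
  intro e he
  obtain ⟨A, h1, h2⟩ := h e he
  rcases exists_isCut h1 h2 with h | h
  exacts [⟨_, h⟩, ⟨_, h⟩]

theorem IsCut.crosses {C : Finset (ι × κ)} {e : ι × κ} {A : Set (ι ⊕ κ)} (h : IsCut C e A) :
    Crosses A e := by
  have h1 := h.1; have h2 := h.2.1
  simp only [Crosses]; tauto

variable [DecidableEq ι] [DecidableEq κ]

theorem Acyc.insert_edge {C : Finset (ι × κ)} (hC : Acyc C) {A : Set (ι ⊕ κ)} {f : ι × κ}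
    (hA : ∀ e ∈ C, ¬Crosses A e) (hf : Crosses A f) : Acyc (insert f C) := by
  apply acyc_of_crosses
  intro e he
  rcases Finset.mem_insert.1 he with rfl | heC
  · refine ⟨A, hf, fun e' he' hne => hA e' ?_⟩
    exact (Finset.mem_insert.1 he').resolve_left hne
  · obtain ⟨D, hD⟩ := hC e heC
    by_cases hDf : Crosses D f
    · refine ⟨symmDiff D A, ?_, fun e' he' hne => ?_⟩
      · rw [crosses_symmDiff]; have := hD.crosses; have := hA e heC; tauto
      · rw [crosses_symmDiff]
        rcases Finset.mem_insert.1 he' with rfl | h'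
        · tauto
        · have := hD.2.2 e' h' hne; have := hA e' h'; tauto
    · refine ⟨D, hD.crosses, fun e' he' hne => ?_⟩
      rcases Finset.mem_insert.1 he' with rfl | h'
      · exact hDf
      · exact hD.2.2 e' h' hne

/-- Every acyclic set of edges extends to a maximal acyclic set inside a given edge set. -/
theorem Acyc.exists_maximal {N E : Finset (ι × κ)} (hN : Acyc N) (hNE : N ⊆ E) :
    ∃ C, N ⊆ C ∧ C ⊆ E ∧ Acyc C ∧
      ∀ A, (∀ e ∈ C, ¬Crosses A e) → ∀ e ∈ E, ¬Crosses A e := by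
  classical
  obtain ⟨C, hC, hmax⟩ := (E.powerset.filter fun C => N ⊆ C ∧ Acyc C).exists_max_image
    Finset.card ⟨N, by simp [hNE, hN]⟩
  simp only [Finset.mem_filter, Finset.mem_powerset] at hC hmax
  refine ⟨C, hC.2.1, hC.1, hC.2.2, fun A hA e he hcr => ?_⟩
  have heC : e ∉ C := fun h => hA e h hcr
  have := hmax (insert e C) ⟨Finset.insert_subset he hC.1,
    hC.2.1.trans (Finset.subset_insert _ _), Acyc.insert_edge hC.2.2 hA hcr⟩
  rw [Finset.card_insert_of_notMem heC] at this
  omega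

theorem Acyc.exists_spanTree {N E : Finset (ι × κ)} (hN : Acyc N) (hNE : N ⊆ E) (hE : Conn E) :
    ∃ C, N ⊆ C ∧ C ⊆ E ∧ IsSpanTree C := by
  obtain ⟨C, h1, h2, h3, h4⟩ := hN.exists_maximal hNE
  exact ⟨C, h1, h2, h3, fun A hA => hE A (h4 A hA)⟩

omit [DecidableEq ι] [DecidableEq κ] in
/-- A function that is constant along the edges of a connected graph is constant. -/
theorem Conn.const {C : Finset (ι × κ)} (hC : Conn C) {M : Type*} (φ : ι ⊕ κ → M)
    (h : ∀ e ∈ C, φ (Sum.inl e.1) = φ (Sum.inr e.2)) (p q : ι ⊕ κ) : φ p = φ q := by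
  have := hC {w | φ w = φ q} (fun e he => by simp [Crosses, h e he]) q p rfl
  exact this

/-- Deleting the edge `o` of a spanning tree and inserting an edge `f` between the two sides of `o`
gives a spanning tree. -/
theorem IsSpanTree.exchange {C : Finset (ι × κ)} (hC : IsSpanTree C) {o f : ι × κ} (ho : o ∈ C)
    {L : Set (ι ⊕ κ)} (hL : IsCut C o L) (hf : Crosses L f) :
    IsSpanTree (insert f (C.erase o)) := by
  have hL' : ∀ e ∈ C.erase o, ¬Crosses L e := fun e he =>
    hL.2.2 e (Finset.mem_of_mem_erase he) (Finset.ne_of_mem_erase he)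
  refine ⟨Acyc.insert_edge (hC.1.mono (C.erase_subset o)) hL' hf, fun A hA => ?_⟩
  have hA' : ∀ e ∈ C, e ≠ o → ¬Crosses A e := fun e he hne =>
    hA e (Finset.mem_insert_of_mem (Finset.mem_erase.2 ⟨hne, he⟩))
  by_cases hoA : Crosses A o
  · -- then `A` differs from `L` by a trivial set, although `f` leaves `L` only
    exfalso
    have key : ∀ e ∈ C, ¬Crosses (symmDiff A L) e := fun e he => by
      rw [crosses_symmDiff]
      by_cases hne : e = o
      · subst hne; have := hL.crosses; tauto
      · have := hA' e he hne; have := hL.2.2 e he hne; tauto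
    have h1 := hC.2 _ key (Sum.inl f.1) (Sum.inr f.2)
    have h2 := hC.2 _ key (Sum.inr f.2) (Sum.inl f.1)
    have h3 : Crosses (symmDiff A L) f := by
      rw [crosses_symmDiff]; have := hA f (Finset.mem_insert_self _ _); tauto
    exact h3 ⟨h1, h2⟩
  · refine hC.2 A fun e he => ?_
    by_cases hne : e = o
    · subst hne; exact hoA
    · exact hA' e he hne

/-- How tail sides change in an exchange: if an edge `m` pointed to the supply end of the inserted
edge `f`, then it points to the demand end of the deleted edge `o` afterwards. The new tail side is
`A`, or its symmetric difference with `L` or with the complement of `L`. -/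
theorem IsCut.exchange {C : Finset (ι × κ)} (hC : IsSpanTree C) {o f m : ι × κ} (ho : o ∈ C)
    (hm : m ∈ C) (hmo : m ≠ o) {L A : Set (ι ⊕ κ)} (hL : IsCut C o L)
    (hfL : Sum.inl f.1 ∈ L) (hfL' : Sum.inr f.2 ∉ L)
    (hA : IsCut C m A) (hfA : Sum.inl f.1 ∉ A) :
    ∃ A', IsCut (insert f (C.erase o)) m A' ∧ Sum.inr o.2 ∉ A' := by
  have hmL := hL.2.2 m hm hmo
  have hoA := hA.2.2 o ho (Ne.symm hmo)
  have h1 := hL.1; have h2 := hL.2.1; have h3 := hA.1; have h4 := hA.2.1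
  have hcut : ∀ A', Sum.inl m.1 ∈ A' → Sum.inr m.2 ∉ A' → ¬Crosses A' f →
      (∀ e ∈ C, ¬Crosses A e → ¬Crosses L e → ¬Crosses A' e) →
      IsCut (insert f (C.erase o)) m A' := by
    intro A' ha hb hc hd
    refine ⟨ha, hb, fun e he hne => ?_⟩
    rcases Finset.mem_insert.1 he with rfl | he
    · exact hc
    · have := Finset.mem_of_mem_erase he
      exact hd e this (hA.2.2 e this hne) (hL.2.2 e this (Finset.ne_of_mem_erase he))
  -- a set built from `A` and `L` that avoids both ends of `m` and of `o` alike is trivial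
  have triv : ∀ D : Set (ι ⊕ κ), (∀ e ∈ C, ¬Crosses A e → ¬Crosses L e → ¬Crosses D e) →
      ¬Crosses D m → ¬Crosses D o → ∀ p q, p ∈ D → q ∈ D := by
    intro D hD hDm hDo
    refine hC.2 D fun e he => ?_
    by_cases e1 : e = m
    · subst e1; exact hDm
    by_cases e2 : e = o
    · subst e2; exact hDo
    exact hD e he (hA.2.2 e he e1) (hL.2.2 e he e2)
  have nA : (Sum.inl o.1 ∈ A ↔ Sum.inr o.2 ∈ A) := not_not.1 hoA
  have nL : (Sum.inl m.1 ∈ L ↔ Sum.inr m.2 ∈ L) := not_not.1 hmL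
  by_cases hq : Sum.inr f.2 ∈ A <;> by_cases hmL1 : Sum.inl m.1 ∈ L
  · have hb : Sum.inr o.2 ∈ A := by
      by_contra hb
      refine (triv (Lᶜ ∩ A) (fun e _ => ?_) ?_ ?_ (Sum.inr f.2) (Sum.inl f.1) ⟨hfL', hq⟩).1 hfL
      · simp only [Crosses, Set.mem_inter_iff, Set.mem_compl_iff]; grind
      · simp only [Crosses, Set.mem_inter_iff, Set.mem_compl_iff]; grind
      · simp only [Crosses, Set.mem_inter_iff, Set.mem_compl_iff]; grind
    refine ⟨symmDiff A Lᶜ, hcut _ ?_ ?_ ?_ fun e _ => ?_, ?_⟩ <;>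
      simp only [Crosses, Set.mem_symmDiff, Set.mem_compl_iff] <;> grind
  · have hb : Sum.inr o.2 ∉ A := by
      intro hb
      refine (triv (L \ A) (fun e _ => ?_) ?_ ?_ (Sum.inl f.1) (Sum.inr f.2) ⟨hfL, hfA⟩).2 hq
      · simp only [Crosses, Set.mem_sdiff]; grind
      · simp only [Crosses, Set.mem_sdiff]; grind
      · simp only [Crosses, Set.mem_sdiff]; grind
    refine ⟨symmDiff A L, hcut _ ?_ ?_ ?_ fun e _ => ?_, ?_⟩ <;>
      simp only [Crosses, Set.mem_symmDiff] <;> grind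
  · refine ⟨A, hcut A h3 h4 ?_ (fun e _ h _ => h), fun hb => ?_⟩
    · simp only [Crosses]; grind
    · refine (triv (Lᶜ \ A) (fun e _ => ?_) ?_ ?_ (Sum.inr f.2) (Sum.inl f.1) ⟨hfL', hq⟩).1 hfL
      · simp only [Crosses, Set.mem_sdiff, Set.mem_compl_iff]; grind
      · simp only [Crosses, Set.mem_sdiff, Set.mem_compl_iff]; grind
      · simp only [Crosses, Set.mem_sdiff, Set.mem_compl_iff]; grind
  · refine ⟨A, hcut A h3 h4 ?_ (fun e _ h _ => h), fun hb => ?_⟩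
    · simp only [Crosses]; grind
    · refine hfL' (triv (L \ A) (fun e _ => ?_) ?_ ?_ (Sum.inl f.1) (Sum.inr f.2) ⟨hfL, hfA⟩).1
      · simp only [Crosses, Set.mem_sdiff]; grind
      · simp only [Crosses, Set.mem_sdiff]; grind
      · simp only [Crosses, Set.mem_sdiff]; grind

end Trees

/-! ### Flows on trees -/

section TreeFlows

variable {ι κ : Type*} [Fintype ι] [Fintype κ]

open Classical in
/-- The flow through an edge whose removal separates `A` from the rest is determined by the
margins. -/
theorem IsCut.flow_eq {Γ : Type*} [AddCommGroup Γ] {E : Finset (ι × κ)} {e : ι × κ}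
    {A : Set (ι ⊕ κ)} (hA : IsCut E e A) {z : ι → κ → Γ} (hz : ∀ i j, (i, j) ∉ E → z i j = 0) :
    z e.1 e.2 = (∑ i, if Sum.inl i ∈ A then ∑ j, z i j else 0) -
      ∑ j, if Sum.inr j ∈ A then ∑ i, z i j else 0 := by
  have h1 : (∑ i, if Sum.inl i ∈ A then ∑ j, z i j else 0) =
      ∑ i, ∑ j, if Sum.inl i ∈ A then z i j else 0 := by
    refine Finset.sum_congr rfl fun i _ => ?_
    split_ifs <;> simp
  have h2 : (∑ j, if Sum.inr j ∈ A then ∑ i, z i j else 0) =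
      ∑ i, ∑ j, if Sum.inr j ∈ A then z i j else 0 := by
    rw [Finset.sum_comm]
    refine Finset.sum_congr rfl fun j _ => ?_
    split_ifs <;> simp
  rw [h1, h2, ← Finset.sum_sub_distrib]
  simp only [← Finset.sum_sub_distrib]
  have h3 : ∀ i j, (i, j) ≠ e →
      ((if Sum.inl i ∈ A then z i j else 0) - if Sum.inr j ∈ A then z i j else 0) = 0 := by
    intro i j hne
    by_cases hE : (i, j) ∈ E
    · have := hA.2.2 _ hE hne
      simp only [Crosses, not_not] at this
      by_cases h : Sum.inl i ∈ A
      · simp [h, this.1 h]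
      · simp [h, mt this.2 h]
    · simp [hz i j hE]
  rw [Finset.sum_eq_single e.1, Finset.sum_eq_single e.2]
  · simp [hA.1, hA.2.1]
  · intro j _ hj; exact h3 _ _ fun h => hj (by rw [← h])
  · simp
  · intro i _ hi
    exact Finset.sum_eq_zero fun j _ => h3 _ _ fun h => hi (by rw [← h])
  · simp

open Classical in
/-- The unit flow from `p` to `q` in the tree `C`, where `A e` is the tail side of the edge `e`. -/
noncomputable def treeFlow (C : Finset (ι × κ)) (A : ι × κ → Set (ι ⊕ κ)) (p q : ι ⊕ κ) (i : ι)
    (j : κ) : ℤ :=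
  if (i, j) ∈ C then (if p ∈ A (i, j) then 1 else 0) - (if q ∈ A (i, j) then 1 else 0) else 0

variable {C : Finset (ι × κ)} {A : ι × κ → Set (ι ⊕ κ)}

omit [Fintype ι] [Fintype κ] in
open Classical in
/-- Each edge of the tree crosses its own cut only. -/
theorem ind_sub_ind (hA : ∀ e ∈ C, IsCut C e (A e)) {e f : ι × κ} (he : e ∈ C) (hf : f ∈ C) :
    ((if Sum.inl f.1 ∈ A e then 1 else 0) - (if Sum.inr f.2 ∈ A e then 1 else 0) : ℤ) =
      if f = e then 1 else 0 := by
  have h := hA e he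
  by_cases hfe : f = e
  · subst hfe; simp [h.1, h.2.1]
  · have := h.2.2 f hf hfe
    simp only [Crosses, not_not] at this
    simp [hfe, this]

omit [Fintype ι] in
open Classical in
theorem treeFlow_row (hC : IsSpanTree C) (hA : ∀ e ∈ C, IsCut C e (A e)) (p q : ι ⊕ κ) (i : ι) :
    ∑ j, treeFlow C A p q i j = (if p = Sum.inl i then 1 else 0) - if q = Sum.inl i then 1 else 0 := by
  have key := hC.2.const (fun z => (∑ j, if (i, j) ∈ C then
    (if z ∈ A (i, j) then 1 else 0 : ℤ) else 0) - if z = Sum.inl i then 1 else 0) ?_ p q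
  · simp only [treeFlow]
    have : ∀ j, (if (i, j) ∈ C then ((if p ∈ A (i, j) then 1 else 0) -
        (if q ∈ A (i, j) then 1 else 0) : ℤ) else 0) =
        (if (i, j) ∈ C then (if p ∈ A (i, j) then 1 else 0) else 0) -
        (if (i, j) ∈ C then (if q ∈ A (i, j) then 1 else 0) else 0) := by
      intro j; split_ifs <;> simp
    simp only [this, Finset.sum_sub_distrib]
    linarith
  · intro f hf
    have h1 : (∑ j, if (i, j) ∈ C then (if Sum.inl f.1 ∈ A (i, j) then 1 else 0 : ℤ) else 0) -
        (∑ j, if (i, j) ∈ C then (if Sum.inr f.2 ∈ A (i, j) then 1 else 0 : ℤ) else 0) =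
        ∑ j, if f = (i, j) then 1 else 0 := by
      rw [← Finset.sum_sub_distrib]
      refine Finset.sum_congr rfl fun j _ => ?_
      by_cases h : (i, j) ∈ C
      · simp only [h, if_true]; exact ind_sub_ind hA h hf
      · have : f ≠ (i, j) := fun h' => h (h' ▸ hf)
        simp [h, this]
    have h2 : (∑ j, if f = (i, j) then (1 : ℤ) else 0) = if f.1 = i then 1 else 0 := by
      by_cases h : f.1 = i
      · rw [Finset.sum_eq_single f.2]
        · simp [Prod.ext_iff, h]
        · intro j _ hj; rw [if_neg]; rintro rfl; exact hj rfl
        · simp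
      · simp [Prod.ext_iff, h]
    rw [h2] at h1
    have h3 : (if (Sum.inl f.1 : ι ⊕ κ) = Sum.inl i then (1 : ℤ) else 0) = if f.1 = i then 1 else 0 := by
      simp
    have h4 : (if (Sum.inr f.2 : ι ⊕ κ) = Sum.inl i then (1 : ℤ) else 0) = 0 := by simp
    rw [h3, h4]
    linarith

omit [Fintype κ] in
open Classical in
theorem treeFlow_col (hC : IsSpanTree C) (hA : ∀ e ∈ C, IsCut C e (A e)) (p q : ι ⊕ κ) (j : κ) :
    ∑ i, treeFlow C A p q i j = (if q = Sum.inr j then 1 else 0) - if p = Sum.inr j then 1 else 0 := by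
  have key := hC.2.const (fun z => (∑ i, if (i, j) ∈ C then
    (if z ∈ A (i, j) then 1 else 0 : ℤ) else 0) + if z = Sum.inr j then 1 else 0) ?_ p q
  · simp only [treeFlow]
    have : ∀ i, (if (i, j) ∈ C then ((if p ∈ A (i, j) then 1 else 0) -
        (if q ∈ A (i, j) then 1 else 0) : ℤ) else 0) =
        (if (i, j) ∈ C then (if p ∈ A (i, j) then 1 else 0) else 0) -
        (if (i, j) ∈ C then (if q ∈ A (i, j) then 1 else 0) else 0) := by
      intro j; split_ifs <;> simp
    simp only [this, Finset.sum_sub_distrib]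
    linarith
  · intro f hf
    have h1 : (∑ i, if (i, j) ∈ C then (if Sum.inl f.1 ∈ A (i, j) then 1 else 0 : ℤ) else 0) -
        (∑ i, if (i, j) ∈ C then (if Sum.inr f.2 ∈ A (i, j) then 1 else 0 : ℤ) else 0) =
        ∑ i, if f = (i, j) then 1 else 0 := by
      rw [← Finset.sum_sub_distrib]
      refine Finset.sum_congr rfl fun i _ => ?_
      by_cases h : (i, j) ∈ C
      · simp only [h, if_true]; exact ind_sub_ind hA h hf
      · have : f ≠ (i, j) := fun h' => h (h' ▸ hf)
        simp [h, this]
    have h2 : (∑ i, if f = (i, j) then (1 : ℤ) else 0) = if f.2 = j then 1 else 0 := by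
      by_cases h : f.2 = j
      · rw [Finset.sum_eq_single f.1]
        · simp [Prod.ext_iff, h]
        · intro i _ hi; rw [if_neg]; rintro rfl; exact hi rfl
        · simp
      · simp [Prod.ext_iff, h]
    rw [h2] at h1
    have h3 : (if (Sum.inr f.2 : ι ⊕ κ) = Sum.inr j then (1 : ℤ) else 0) = if f.2 = j then 1 else 0 := by
      simp
    have h4 : (if (Sum.inl f.1 : ι ⊕ κ) = Sum.inr j then (1 : ℤ) else 0) = 0 := by simp
    rw [h3, h4]
    linarith

omit [Fintype ι] [Fintype κ] in
theorem Acyc.exists_cuts (hC : Acyc C) : ∃ A : ι × κ → Set (ι ⊕ κ), ∀ e ∈ C, IsCut C e (A e) := by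
  classical
  exact ⟨fun e => if h : e ∈ C then (hC e h).choose else ∅, fun e he => by
    simpa [he] using (hC e he).choose_spec⟩

/-- A tree rooted at a supply `ρ`: `pd j` is the parent of the demand `j`; an edge `(i, j)` with
`pd j ≠ i` leads from the supply `i` up to its parent `j`, and `h` measures the depth of the
supplies. -/
structure Rooting (S : Finset (ι × κ)) (ρ : ι) (pd : κ → ι) (h : ι → ℕ) : Prop where
  down_mem : ∀ j, (pd j, j) ∈ S
  depth : ∀ i j, (i, j) ∈ S → pd j ≠ i → h (pd j) < h i
  exists_up : ∀ i, i ≠ ρ → ∃ j, (i, j) ∈ S ∧ pd j ≠ i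
  up_unique : ∀ i j j', (i, j) ∈ S → (i, j') ∈ S → pd j ≠ i → pd j' ≠ i → j = j'
  root : ∀ j, (ρ, j) ∈ S → pd j = ρ

theorem exists_unique_of_sum_eq_one {α : Type*} [Fintype α] {P : α → Prop} [DecidablePred P]
    (h : (∑ a, if P a then (1 : ℤ) else 0) = 1) : ∃ a, P a ∧ ∀ b, P b → b = a := by
  rw [Finset.sum_boole] at h
  obtain ⟨a, ha⟩ := Finset.card_eq_one.1 (by exact_mod_cast h)
  have : ∀ b, P b ↔ b = a := fun b => by
    rw [← Finset.mem_singleton (a := a), ← ha]; simp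
  exact ⟨a, (this a).2 rfl, fun b hb => (this b).1 hb⟩

open Classical in
/-- The parent edge of a demand is its edge whose tail side contains the root, and the edge up from
a supply is its edge whose tail side does not contain the root. Both are unique, since unit flows
to or from the root are sent along these edges. The depth of a supply counts the edges that separate
it from the root. -/
theorem IsSpanTree.exists_rooting (hC : IsSpanTree C) (ρ : ι) : ∃ pd h, Rooting C ρ pd h := by
  obtain ⟨A, hA⟩ := hC.1.exists_cuts
  have h1 : ∀ j, ∃ i, ((i, j) ∈ C ∧ Sum.inl ρ ∈ A (i, j)) ∧
      ∀ i', ((i', j) ∈ C ∧ Sum.inl ρ ∈ A (i', j)) → i' = i := by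
    intro j
    apply exists_unique_of_sum_eq_one
    have := treeFlow_col hC hA (Sum.inl ρ) (Sum.inr j) j
    simp only [reduceCtorEq, if_false, if_true, sub_zero] at this
    refine Eq.trans (Finset.sum_congr rfl fun i _ => ?_) this
    simp only [treeFlow]
    by_cases h : (i, j) ∈ C
    · have := (hA _ h).2.1
      simp only at this
      simp [h, this]
    · simp [h]
  choose pd hpd hpd' using h1
  have hiff : ∀ i j, (i, j) ∈ C → (pd j = i ↔ Sum.inl ρ ∈ A (i, j)) := fun i j hij =>
    ⟨fun h => h ▸ (hpd j).2, fun h => (hpd' j i ⟨hij, h⟩).symm⟩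
  have h2 : ∀ i, i ≠ ρ → ∃ j, ((i, j) ∈ C ∧ Sum.inl ρ ∉ A (i, j)) ∧
      ∀ j', ((i, j') ∈ C ∧ Sum.inl ρ ∉ A (i, j')) → j' = j := by
    intro i hi
    apply exists_unique_of_sum_eq_one
    have := treeFlow_row hC hA (Sum.inl i) (Sum.inl ρ) i
    simp only [Sum.inl.injEq, if_true, Ne.symm hi, if_false, sub_zero] at this
    refine Eq.trans (Finset.sum_congr rfl fun j _ => ?_) this
    simp only [treeFlow]
    by_cases h : (i, j) ∈ C
    · have := (hA _ h).1
      simp only at this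
      by_cases h' : Sum.inl ρ ∈ A (i, j) <;> simp [h, this, h']
    · simp [h]
  refine ⟨pd, fun i => (C.filter fun e => Crosses (A e) e ∧
    ¬(Sum.inl i ∈ A e ↔ Sum.inl ρ ∈ A e)).card, fun j => (hpd j).1, ?_, ?_, ?_, ?_⟩
  · intro i j hij hne
    have hup : Sum.inl ρ ∉ A (i, j) := fun h => hne ((hiff i j hij).2 h)
    have hdn := hpd j
    have c1 := hA _ hij
    have c2 := hA _ hdn.1
    have hne' : (pd j, j) ≠ (i, j) := fun h => hne (congrArg Prod.fst h)
    have n1 := c1.2.2 _ hdn.1 hne'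
    simp only [Crosses, not_not] at n1
    apply Finset.card_lt_card
    refine ⟨fun e he => ?_, fun hsub => ?_⟩
    · simp only [Finset.mem_filter] at he ⊢
      obtain ⟨he, hc, hs⟩ := he
      refine ⟨he, hc, ?_⟩
      have e1 : e ≠ (i, j) := by
        rintro rfl
        have := c1.2.1
        tauto
      have e2 : e ≠ (pd j, j) := by
        rintro rfl
        have := c2.1
        tauto
      have d1 := (hA e he).2.2 _ hij (Ne.symm e1)
      have d2 := (hA e he).2.2 _ hdn.1 (Ne.symm e2)
      simp only [Crosses, not_not] at d1 d2
      tauto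
    · have : (i, j) ∈ C.filter fun e => Crosses (A e) e ∧
          ¬(Sum.inl i ∈ A e ↔ Sum.inl ρ ∈ A e) := by
        simp only [Finset.mem_filter]
        refine ⟨hij, c1.crosses, ?_⟩
        have := c1.1
        tauto
      have := hsub this
      simp only [Finset.mem_filter] at this
      have h3 := c1.2.1
      tauto
  · intro i hi
    obtain ⟨j, ⟨hj, hj'⟩, -⟩ := h2 i hi
    exact ⟨j, hj, fun h => hj' ((hiff i j hj).1 h)⟩
  · intro i j j' hj hj' hn hn'
    have hi : i ≠ ρ := by
      rintro rfl
      exact hn ((hiff _ _ hj).2 (hA _ hj).1)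
    obtain ⟨k, -, hk⟩ := h2 i hi
    rw [hk j ⟨hj, fun h => hn ((hiff _ _ hj).2 h)⟩, hk j' ⟨hj', fun h => hn' ((hiff _ _ hj').2 h)⟩]
  · intro j hj
    exact (hiff _ _ hj).2 (hA _ hj).1

theorem IsSpanTree.card [Nonempty ι] (hC : IsSpanTree C) :
    C.card + 1 = Fintype.card ι + Fintype.card κ := by
  classical
  obtain ⟨ρ⟩ := ‹Nonempty ι›
  obtain ⟨pd, h, hr⟩ := hC.exists_rooting ρ
  have h1 : (C.filter fun e => pd e.2 = e.1).card = Fintype.card κ := by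
    rw [← Finset.card_univ]
    refine (Finset.card_bij (fun j _ => (pd j, j)) ?_ ?_ ?_).symm
    · intro j _; simp [hr.down_mem j]
    · intro a _ b _ hab; exact congrArg Prod.snd hab
    · rintro ⟨i, j⟩ he
      simp only [Finset.mem_filter] at he
      exact ⟨j, Finset.mem_univ _, by rw [he.2]⟩
  have h2 : (C.filter fun e => ¬pd e.2 = e.1).card = (Finset.univ.erase ρ).card := by
    refine Finset.card_bij (fun e _ => e.1) ?_ ?_ ?_
    · rintro ⟨i, j⟩ he
      simp only [Finset.mem_filter] at he
      simp only [Finset.mem_erase, Finset.mem_univ, and_true]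
      rintro rfl
      exact he.2 (hr.root _ he.1)
    · rintro ⟨i, j⟩ he ⟨i', j'⟩ he' (rfl : i = i')
      simp only [Finset.mem_filter] at he he'
      rw [hr.up_unique i j j' he.1 he'.1 he.2 he'.2]
    · intro i hi
      obtain ⟨j, hj, hn⟩ := hr.exists_up i (Finset.ne_of_mem_erase hi)
      exact ⟨(i, j), by simp [hj, hn], rfl⟩
  rw [Finset.card_erase_of_mem (Finset.mem_univ _), Finset.card_univ] at h2
  have h3 := Finset.card_filter_add_card_filter_not (s := C) fun e => pd e.2 = e.1
  have : 0 < Fintype.card ι := Fintype.card_pos_iff.2 ⟨ρ⟩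
  omega

end TreeFlows

/-! ### Walking to a target tree without ever deleting an inserted edge -/

section Walk

variable {ι κ : Type*} [Fintype ι] [Fintype κ] [DecidableEq ι] [DecidableEq κ]
variable {Γ : Type*} [AddCommGroup Γ] [LinearOrder Γ] [IsOrderedAddMonoid Γ]

/-- `x` is a nonnegative flow with margins `u` and `v` that uses only edges of `E`. Flows take
values in an ordered group, so that infinitesimal perturbations are covered. -/
structure IsFlow (E : Finset (ι × κ)) (u : ι → Γ) (v : κ → Γ) (x : ι → κ → Γ) : Prop where
  row : ∀ i, ∑ j, x i j = u i
  col : ∀ j, ∑ i, x i j = v j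
  nonneg : ∀ i j, 0 ≤ x i j
  supp : ∀ i j, (i, j) ∉ E → x i j = 0

/-- The demand `j` is frozen in the tree `C` with inserted edges `T`: its parent edge has been
inserted, and all its edges in `C` are inserted ones. -/
def Frozen (pd : κ → ι) (C T : Finset (ι × κ)) (j : κ) : Prop :=
  (pd j, j) ∈ T ∧ ∀ i, (i, j) ∈ C → (i, j) ∈ T

/-- The invariant of the walk. `C` is the current tree with flow `x`, and `T` the set of inserted
edges of the target tree `S`. An edge up to a parent is inserted only after all children of its
supply end are frozen, and all inserted edges, except the parent edges of frozen demands, point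
towards a common node. -/
structure WalkState (E S : Finset (ι × κ)) (pd : κ → ι) (u : ι → Γ) (v : κ → Γ)
    (C T : Finset (ι × κ)) (x : ι → κ → Γ) : Prop where
  tree : IsSpanTree C
  sub : C ⊆ E
  flow : IsFlow C u v x
  TC : T ⊆ C
  TS : T ⊆ S
  up : ∀ i j, (i, j) ∈ T → pd j ≠ i → ∀ j', pd j' = i → Frozen pd C T j'
  point : ∃ r, ∀ e ∈ T, ¬(pd e.2 = e.1 ∧ Frozen pd C T e.2) → ∃ A, IsCut C e A ∧ r ∉ A

variable {E S C T : Finset (ι × κ)} {ρ : ι} {pd : κ → ι} {h : ι → ℕ} {u : ι → Γ} {v : κ → Γ}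
  {x g : ι → κ → Γ}

omit [DecidableEq ι] [DecidableEq κ] [IsOrderedAddMonoid Γ] in
theorem IsFlow.mono {D : Finset (ι × κ)} (hx : IsFlow C u v x) (hCD : C ⊆ D) : IsFlow D u v x :=
  ⟨hx.row, hx.col, hx.nonneg, fun i j hij => hx.supp i j fun h => hij (hCD h)⟩

omit [Fintype ι] [Fintype κ] in
theorem Frozen.insert_edge {D : Finset (ι × κ)} {f : ι × κ} {j : κ} (hj : Frozen pd C T j)
    (hD : D ⊆ insert f C) : Frozen pd D (insert f T) j := by
  refine ⟨Finset.mem_insert_of_mem hj.1, fun i hi => ?_⟩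
  rcases Finset.mem_insert.1 (hD hi) with h | h
  · exact Finset.mem_insert.2 (Or.inl h)
  · exact Finset.mem_insert_of_mem (hj.2 i h)

theorem le_of_sum_eq {α : Type*} [Fintype α] [DecidableEq α] {a b : α → Γ} (k : α)
    (hs : ∑ i, a i = ∑ i, b i) (hk : ∀ i, i ≠ k → a i ≤ b i) : b k ≤ a k := by
  rw [← Finset.add_sum_erase _ a (Finset.mem_univ k),
    ← Finset.add_sum_erase _ b (Finset.mem_univ k)] at hs
  have h1 : ∑ i ∈ Finset.univ.erase k, a i ≤ ∑ i ∈ Finset.univ.erase k, b i :=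
    Finset.sum_le_sum fun i hi => hk i (Finset.ne_of_mem_erase hi)
  refine le_of_add_le_add_right (a := ∑ i ∈ Finset.univ.erase k, b i) ?_
  rw [← hs]
  gcongr

/-- The parent edge of a frozen demand carries at least its target flow, if the other inserted edges
there carry at most theirs. -/
theorem Frozen.le (hg : IsFlow S u v g) (hx : IsFlow C u v x) {j : κ} (hj : Frozen pd C T j)
    (hup : ∀ i, (i, j) ∈ T → pd j ≠ i → x i j ≤ g i j) : g (pd j) j ≤ x (pd j) j := by
  refine le_of_sum_eq (a := fun i => x i j) (b := fun i => g i j) (pd j)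
    ((hx.col j).trans (hg.col j).symm) fun i hi => ?_
  by_cases h : (i, j) ∈ C
  · exact hup i (hj.2 i h) hi.symm
  · rw [hx.supp i j h]; exact hg.nonneg i j

/-- Inserted edges up to a parent never carry more than in the target flow: everything below them
is frozen. -/
theorem up_le (hr : Rooting S ρ pd h) (hg : IsFlow S u v g) (hx : IsFlow C u v x) (hTS : T ⊆ S)
    (hup : ∀ i j, (i, j) ∈ T → pd j ≠ i → ∀ j', pd j' = i → Frozen pd C T j') (i : ι) (j : κ)
    (hij : (i, j) ∈ T) (hne : pd j ≠ i) : x i j ≤ g i j := by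
  obtain ⟨N, hN⟩ : ∃ N, ∀ i, h i ≤ N :=
    ⟨Finset.univ.sup h, fun i => Finset.le_sup (Finset.mem_univ i)⟩
  induction hk : N - h i using Nat.strong_induction_on generalizing i j with
  | _ k ih =>
  refine le_of_sum_eq (a := fun j => g i j) (b := fun j => x i j) j
    ((hg.row i).trans (hx.row i).symm) fun j' hj' => ?_
  by_cases hp : pd j' = i
  · have hfr := hup i j hij hne j' hp
    have := hfr.le hg hx fun i' hi' hne' => by
      have hd := hr.depth i' j' (hTS hi') hne'
      rw [hp] at hd
      have := hN i'
      exact ih (N - h i') (by omega) i' j' hi' hne' rfl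
    rwa [hp] at this
  · have : (i, j') ∉ S := fun h' => hj' (hr.up_unique i j' j h' (hTS hij) hp hne)
    simp only [hg.supp i j' this]
    exact hx.nonneg i j'

theorem eq_of_sum_eq_of_le {α : Type*} [Fintype α] {a b : α → Γ}
    (hs : ∑ i, a i = ∑ i, b i) (hk : ∀ i, a i ≤ b i) (i : α) : a i = b i :=
  (Finset.sum_eq_sum_iff_of_le fun i _ => hk i).1 hs i (Finset.mem_univ i)

/-- If the demands below the root are frozen, the current flow is the target flow. -/
theorem WalkState.eq_of_root (hr : Rooting S ρ pd h) (hg : IsFlow S u v g)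
    (hpos : ∀ i j, (i, j) ∈ S → 0 < g i j) (hs : WalkState E S pd u v C T x)
    (hroot : ∀ j, pd j = ρ → Frozen pd C T j) : x = g := by
  have hupl := up_le hr hg hs.flow hs.TS hs.up
  have hdown : ∀ j, Frozen pd C T j → g (pd j) j ≤ x (pd j) j := fun j hj =>
    hj.le hg hs.flow fun i => hupl i j
  suffices H : ∀ i, (∀ j, x i j = g i j) ∧ ∀ j, pd j = i → Frozen pd C T j by
    funext i j; exact (H i).1 j
  intro i
  induction hk : h i using Nat.strong_induction_on generalizing i with
  | _ k ih =>
  by_cases hi : i = ρ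
  · subst hi
    refine ⟨fun j => (eq_of_sum_eq_of_le (a := fun j => g i j) (b := fun j => x i j)
      ((hg.row i).trans (hs.flow.row i).symm) (fun j => ?_) j).symm, hroot⟩
    by_cases hj : (i, j) ∈ S
    · have hp := hr.root j hj
      have := hdown j (hroot j hp)
      rwa [hp] at this
    · simp only [hg.supp i j hj]; exact hs.flow.nonneg i j
  · obtain ⟨j, hj, hne⟩ := hr.exists_up i hi
    obtain ⟨h1, h2⟩ := ih (h (pd j)) (hk ▸ hr.depth i j hj hne) (pd j) rfl
    have hfr := h2 j rfl
    have hxj : x i j = g i j := by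
      refine eq_of_sum_eq_of_le (a := fun i => x i j) (b := fun i => g i j)
        ((hs.flow.col j).trans (hg.col j).symm) (fun i' => ?_) i
      by_cases hi' : pd j = i'
      · subst hi'; exact (h1 j).le
      · by_cases hc : (i', j) ∈ C
        · exact hupl i' j (hfr.2 i' hc) hi'
        · simp only [hs.flow.supp i' j hc]; exact hg.nonneg i' j
    have hC : (i, j) ∈ C := by
      by_contra hc
      exact (hpos i j hj).ne' (hxj ▸ hs.flow.supp i j hc)
    have h3 := hs.up i j (hfr.2 i hC) hne
    refine ⟨fun j' => (eq_of_sum_eq_of_le (a := fun j => g i j) (b := fun j => x i j)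
      ((hg.row i).trans (hs.flow.row i).symm) (fun j' => ?_) j').symm, h3⟩
    by_cases hp : pd j' = i
    · have := hdown j' (h3 j' hp)
      rwa [hp] at this
    · by_cases hS : (i, j') ∈ S
      · rw [hr.up_unique i j' j hS hj hp hne]; exact hxj.ge
      · simp only [hg.supp i j' hS]; exact hs.flow.nonneg i j'

omit [Fintype ι] [Fintype κ] [DecidableEq ι] [DecidableEq κ] in
theorem IsCut.subset {e : ι × κ} {A B : Set (ι ⊕ κ)} (hC : Conn C) (he : e ∈ C) (hA : IsCut C e A)
    (hB : IsCut C e B) : A ⊆ B := by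
  intro p hp
  by_contra hpB
  have h1 := hA.1; have h2 := hB.1; have h3 := hA.2.1; have h4 := hB.2.1
  have := hC (A \ B) (fun e' he' => by
    by_cases hne : e' = e
    · subst hne; simp only [Crosses, Set.mem_sdiff]; tauto
    · have n1 := hA.2.2 e' he' hne
      have n2 := hB.2.2 e' he' hne
      simp only [Crosses, Set.mem_sdiff] at *
      tauto) p (Sum.inl e.1) ⟨hp, hpB⟩
  exact this.2 h2

/-- The common node to which the inserted edges point may be taken to be a supply. -/
theorem WalkState.exists_supply (hr : Rooting S ρ pd h) (hg : IsFlow S u v g)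
    (hpos : ∀ i j, (i, j) ∈ S → 0 < g i j) (hs : WalkState E S pd u v C T x) :
    ∃ s, ∀ e ∈ T, ¬(pd e.2 = e.1 ∧ Frozen pd C T e.2) → ∃ A, IsCut C e A ∧ Sum.inl s ∉ A := by
  obtain ⟨r | j, hrt⟩ := hs.point
  · exact ⟨r, hrt⟩
  by_cases hex : ∃ i, (i, j) ∈ C ∧ ((i, j) ∉ T ∨ (pd j = i ∧ Frozen pd C T j))
  · obtain ⟨i, hi, hi'⟩ := hex
    refine ⟨i, fun e he hn => ?_⟩
    obtain ⟨A, hA, hjA⟩ := hrt e he hn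
    refine ⟨A, hA, fun hiA => hjA ?_⟩
    have hne : (i, j) ≠ e := by
      rintro rfl
      rcases hi' with h' | h'
      exacts [h' he, hn h']
    exact (not_not.1 (hA.2.2 _ hi hne)).1 hiA
  · -- otherwise all edges at `j` are inserted edges from children, which carry at most their
    -- target flow, and the positive target flow on the parent edge of `j` is missing
    exfalso
    push Not at hex
    have hall : ∀ i, (i, j) ∈ C → (i, j) ∈ T := fun i hi => (hex i hi).1
    have hpd : (pd j, j) ∉ C := fun hc => (hex _ hc).2 rfl ⟨hall _ hc, hall⟩
    have hlt : ∑ i, x i j < ∑ i, g i j := by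
      refine Finset.sum_lt_sum (fun i _ => ?_) ⟨pd j, Finset.mem_univ _, ?_⟩
      · by_cases hc : (i, j) ∈ C
        · exact up_le hr hg hs.flow hs.TS hs.up i j (hall i hc) fun h' => hpd (h' ▸ hc)
        · rw [hs.flow.supp i j hc]; exact hg.nonneg i j
      · rw [hs.flow.supp _ _ hpd]; exact hpos _ _ (hr.down_mem j)
    rw [hs.flow.col, hg.col] at hlt
    exact lt_irrefl _ hlt

/-- Inserting the edge `f = (s, q)` whose tail is the node to which the inserted edges point:
some edge that is not an inserted one can be deleted. -/
theorem WalkState.pivot (hr : Rooting S ρ pd h) (hg : IsFlow S u v g) (hSE : S ⊆ E)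
    (hpos : ∀ i j, (i, j) ∈ S → 0 < g i j) (hs : WalkState E S pd u v C T x) {s : ι} {q : κ}
    (hpt : ∀ e ∈ T, ¬(pd e.2 = e.1 ∧ Frozen pd C T e.2) → ∃ A, IsCut C e A ∧ Sum.inl s ∉ A)
    (hf : (s, q) ∈ S) (hfC : (s, q) ∉ C)
    (hup : pd q ≠ s → ∀ j', pd j' = s → Frozen pd C T j') :
    ∃ o ∈ C, ∃ x', WalkState E S pd u v (insert (s, q) (C.erase o)) (insert (s, q) T) x' := by
  classical
  obtain ⟨A, hA⟩ := hs.tree.1.exists_cuts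
  set d : ι → κ → ℤ := treeFlow C A (Sum.inr q) (Sum.inl s) with hd
  have hrow : ∀ i, ∑ j, d i j = -(if s = i then 1 else 0) := fun i => by
    rw [hd, treeFlow_row hs.tree hA]; simp
  have hcol : ∀ j, ∑ i, d i j = -(if q = j then 1 else 0) := fun j => by
    rw [hd, treeFlow_col hs.tree hA]; simp
  have hdC : ∀ i j, (i, j) ∉ C → d i j = 0 := fun i j hij => by simp [hd, treeFlow, hij]
  have hdneg : ∀ i j, d i j < 0 → (i, j) ∈ C ∧ d i j = -1 ∧ Sum.inl s ∈ A (i, j) ∧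
      Sum.inr q ∉ A (i, j) := by
    intro i j hij
    have hC : (i, j) ∈ C := by by_contra hc; simp [hdC i j hc] at hij
    simp only [hd, treeFlow, hC, if_true] at hij ⊢
    by_cases h1 : Sum.inr q ∈ A (i, j) <;> by_cases h2 : Sum.inl s ∈ A (i, j) <;>
      simp [h1, h2] at hij ⊢
  -- the edges losing flow along the cycle, and the first of them to become empty
  obtain ⟨o, ho, hmin⟩ := ((Finset.univ : Finset (ι × κ)).filter fun e => d e.1 e.2 < 0)
    |>.exists_min_image (fun e => x e.1 e.2) (by
      by_contra hne
      rw [Finset.not_nonempty_iff_eq_empty, Finset.filter_eq_empty_iff] at hne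
      have : 0 ≤ ∑ j, d s j := Finset.sum_nonneg fun j _ => not_lt.1 (hne (Finset.mem_univ (s, j)))
      rw [hrow] at this
      simp at this)
  simp only [Finset.mem_filter, Finset.mem_univ, true_and] at ho hmin
  obtain ⟨hoC, hod, hsL, hqL⟩ := hdneg o.1 o.2 ho
  simp only [Prod.mk.eta] at hoC hsL hqL
  have hθ : 0 ≤ x o.1 o.2 := hs.flow.nonneg _ _
  let x' : ι → κ → Γ := fun i j =>
    x i j + (d i j + if (i, j) = (s, q) then 1 else 0) • x o.1 o.2
  have hx' : IsFlow (insert (s, q) C) u v x' := by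
    refine ⟨fun i => ?_, fun j => ?_, fun i j => ?_, fun i j hij => ?_⟩
    · simp only [x', Finset.sum_add_distrib, ← Finset.sum_smul, hs.flow.row, hrow]
      by_cases hi : s = i
      · subst hi; simp
      · simp [hi, Ne.symm hi]
    · simp only [x', Finset.sum_add_distrib, ← Finset.sum_smul, hs.flow.col, hcol]
      by_cases hj : q = j
      · subst hj; simp
      · simp [hj, Ne.symm hj]
    · simp only [x']
      by_cases hneg : d i j < 0
      · have h1 := hdneg i j hneg
        have hne : (i, j) ≠ (s, q) := fun h' => hfC (h' ▸ h1.1)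
        rw [h1.2.1, if_neg hne]
        simpa using hmin (i, j) hneg
      · refine add_nonneg (hs.flow.nonneg i j) (zsmul_nonneg hθ ?_)
        split_ifs <;> linarith
    · simp only [Finset.mem_insert, not_or] at hij
      simp only [x', if_neg hij.1, hdC i j hij.2, hs.flow.supp i j hij.2]
      simp
  have hx'o : x' o.1 o.2 = 0 := by
    have hne : (o.1, o.2) ≠ (s, q) := fun h' => hfC (h' ▸ hoC)
    simp only [x', hod, if_neg hne]; simp
  have hupT : ∀ i j, (i, j) ∈ insert (s, q) T → pd j ≠ i → ∀ j', pd j' = i → ∀ D,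
      D ⊆ insert (s, q) C → Frozen pd D (insert (s, q) T) j' := by
    intro i j hij hne j' hj' D hD
    rcases Finset.mem_insert.1 hij with h' | h'
    · obtain ⟨rfl, rfl⟩ := Prod.mk.inj h'
      exact (hup hne j' hj').insert_edge hD
    · exact (hs.up i j h' hne j' hj').insert_edge hD
  have hT'S : insert (s, q) T ⊆ S := Finset.insert_subset hf hs.TS
  -- parent edges of frozen demands stay positive, and the other inserted edges point to `s`, so
  -- that the cycle increases the flow on them
  have hoT : o ∉ T := by
    intro hoT
    by_cases hsec : pd o.2 = o.1 ∧ Frozen pd C T o.2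
    · have hfr := hsec.2.insert_edge (Finset.Subset.refl (insert (s, q) C))
      have := hfr.le hg hx' fun i hi hne =>
        up_le hr hg hx' hT'S (fun i j hij hne j' hj' =>
          hupT i j hij hne j' hj' _ (Finset.Subset.refl _)) i o.2 hi hne
      rw [hsec.1, hx'o] at this
      exact absurd (hpos _ _ (hs.TS hoT)) (not_lt.2 this)
    · obtain ⟨B, hB, hsB⟩ := hpt o hoT hsec
      exact hsB (IsCut.subset hs.tree.2 hoC (hA o hoC) hB hsL)
  have hD : insert (s, q) (C.erase o) ⊆ insert (s, q) C :=
    Finset.insert_subset_insert _ (Finset.erase_subset _ _)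
  have hfcr : Crosses (A o) (s, q) := by simp only [Crosses]; tauto
  refine ⟨o, hoC, x', hs.tree.exchange hoC (hA o hoC) hfcr, ?_, ?_, ?_, hT'S, ?_,
    Sum.inr o.2, ?_⟩
  · exact Finset.insert_subset (hSE hf) ((Finset.erase_subset _ _).trans hs.sub)
  · refine ⟨hx'.row, hx'.col, hx'.nonneg, fun i j hij => ?_⟩
    by_cases hio : (i, j) = o
    · rw [← hx'o, ← hio]
    · refine hx'.supp i j fun h' => hij ?_
      rcases Finset.mem_insert.1 h' with h' | h'
      · exact Finset.mem_insert.2 (Or.inl h')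
      · exact Finset.mem_insert_of_mem (Finset.mem_erase.2 ⟨hio, h'⟩)
  · refine Finset.insert_subset_insert _ fun e he => Finset.mem_erase.2 ⟨?_, hs.TC he⟩
    rintro rfl; exact hoT he
  · exact fun i j hij hne j' hj' => hupT i j hij hne j' hj' _ hD
  · intro e he hn
    rcases Finset.mem_insert.1 he with rfl | heT
    · refine ⟨A o, ⟨hsL, hqL, fun e' he' hne => ?_⟩, (hA o hoC).2.1⟩
      have := (Finset.mem_insert.1 he').resolve_left hne
      exact (hA o hoC).2.2 e' (Finset.mem_of_mem_erase this) (Finset.ne_of_mem_erase this)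
    · obtain ⟨B, hB, hsB⟩ := hpt e heT fun h' => hn ⟨h'.1, h'.2.insert_edge hD⟩
      have heo : e ≠ o := by rintro rfl; exact hoT heT
      exact IsCut.exchange hs.tree hoC (hs.TC heT) heo (hA o hoC) hsL hqL hB hsB

omit [IsOrderedAddMonoid Γ] in
/-- Inserting an edge that happens to be present already. -/
theorem WalkState.mark (hs : WalkState E S pd u v C T x) {s : ι} {q : κ}
    (hpt : ∀ e ∈ T, ¬(pd e.2 = e.1 ∧ Frozen pd C T e.2) → ∃ A, IsCut C e A ∧ Sum.inl s ∉ A)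
    (hf : (s, q) ∈ S) (hfC : (s, q) ∈ C)
    (hup : pd q ≠ s → ∀ j', pd j' = s → Frozen pd C T j') :
    WalkState E S pd u v C (insert (s, q) T) x := by
  have hD : C ⊆ insert (s, q) C := Finset.subset_insert _ _
  refine ⟨hs.tree, hs.sub, hs.flow, Finset.insert_subset hfC hs.TC, Finset.insert_subset hf hs.TS,
    ?_, Sum.inr q, ?_⟩
  · intro i j hij hne j' hj'
    rcases Finset.mem_insert.1 hij with h' | h'
    · obtain ⟨rfl, rfl⟩ := Prod.mk.inj h'
      exact (hup hne j' hj').insert_edge hD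
    · exact (hs.up i j h' hne j' hj').insert_edge hD
  · intro e he hn
    by_cases hef : e = (s, q)
    · subst hef
      obtain ⟨A, hA⟩ := hs.tree.1 _ hfC
      exact ⟨A, hA, hA.2.1⟩
    · have heT := (Finset.mem_insert.1 he).resolve_left hef
      obtain ⟨B, hB, hsB⟩ := hpt e heT fun h' => hn ⟨h'.1, h'.2.insert_edge hD⟩
      exact ⟨B, hB, fun hq => hsB ((not_not.1 (hB.2.2 _ hfC (Ne.symm hef))).2 hq)⟩

/-- As long as the target is not reached, some further edge of the target tree can be inserted. -/
theorem WalkState.step (hr : Rooting S ρ pd h) (hg : IsFlow S u v g) (hSE : S ⊆ E)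
    (hpos : ∀ i j, (i, j) ∈ S → 0 < g i j) (hs : WalkState E S pd u v C T x) :
    x = g ∨ ∃ f ∈ S, f ∉ T ∧ ((f ∈ C ∧ WalkState E S pd u v C (insert f T) x) ∨
      (f ∉ C ∧ ∃ o ∈ C, ∃ x', WalkState E S pd u v (insert f (C.erase o)) (insert f T) x')) := by
  obtain ⟨s, hpt⟩ := hs.exists_supply hr hg hpos
  have hsT : ∀ j, (s, j) ∈ T → pd j = s ∧ Frozen pd C T j := by
    intro j hj
    by_contra hn
    obtain ⟨A, hA, hsA⟩ := hpt _ hj hn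
    exact hsA hA.1
  have main : ∀ q, (s, q) ∈ S → (s, q) ∉ T → (pd q ≠ s → ∀ j', pd j' = s → Frozen pd C T j') →
      ∃ f ∈ S, f ∉ T ∧ ((f ∈ C ∧ WalkState E S pd u v C (insert f T) x) ∨
      (f ∉ C ∧ ∃ o ∈ C, ∃ x', WalkState E S pd u v (insert f (C.erase o)) (insert f T) x')) := by
    intro q hq hqT hup
    refine ⟨(s, q), hq, hqT, ?_⟩
    by_cases hqC : (s, q) ∈ C
    · exact Or.inl ⟨hqC, hs.mark hpt hq hqC hup⟩
    · exact Or.inr ⟨hqC, hs.pivot hr hg hSE hpos hpt hq hqC hup⟩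
  by_cases hdown : ∃ j, pd j = s ∧ (s, j) ∉ T
  · obtain ⟨j, hj, hjT⟩ := hdown
    exact Or.inr (main j (hj ▸ hr.down_mem j) hjT fun hn => absurd hj hn)
  · push Not at hdown
    have hfr : ∀ j', pd j' = s → Frozen pd C T j' := fun j' hj' => (hsT j' (hdown j' hj')).2
    by_cases hsρ : s = ρ
    · subst hsρ
      exact Or.inl (hs.eq_of_root hr hg hpos hfr)
    · obtain ⟨j, hj, hne⟩ := hr.exists_up s hsρ
      exact Or.inr (main j hj (fun hT => hne (hsT j hT).1) fun _ => hfr)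

/-- A pivot between two flows carried by spanning trees inside `E` that differ by an exchange. -/
def PivotStep (E : Finset (ι × κ)) (u : ι → Γ) (v : κ → Γ) (x y : ι → κ → Γ) : Prop :=
  ∃ C D f, IsSpanTree C ∧ C ⊆ E ∧ IsFlow C u v x ∧ IsSpanTree D ∧ D ⊆ E ∧ IsFlow D u v y ∧
    D ⊆ insert f C

/-- Walks of a given number of pivots. -/
inductive PivotWalk (E : Finset (ι × κ)) (u : ι → Γ) (v : κ → Γ) (y : ι → κ → Γ) :
    (ι → κ → Γ) → ℕ → Prop
  | nil : PivotWalk E u v y y 0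
  | cons {x x' : ι → κ → Γ} {n : ℕ} : PivotStep E u v x x' → PivotWalk E u v y x' n →
      PivotWalk E u v y x (n + 1)

theorem WalkState.exists_walk (hr : Rooting S ρ pd h) (hg : IsFlow S u v g) (hSE : S ⊆ E)
    (hpos : ∀ i j, (i, j) ∈ S → 0 < g i j) {Z : Finset (ι × κ)}
    (hZ : ∀ y, IsFlow E u v y → ∀ e ∈ Z, 0 < y e.1 e.2)
    (hs : WalkState E S pd u v C T x) :
    ∃ n ≤ (S \ (Z ∪ T)).card, PivotWalk E u v g x n := by
  induction hk : (S \ T).card using Nat.strong_induction_on generalizing C T x with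
  | _ k ih =>
  rcases hs.step hr hg hSE hpos with rfl | ⟨f, hfS, hfT, hcase⟩
  · exact ⟨0, Nat.zero_le _, .nil⟩
  have hlt : (S \ insert f T).card < k := by
    rw [← hk]
    refine Finset.card_lt_card ⟨Finset.sdiff_subset_sdiff subset_rfl (Finset.subset_insert _ _),
      fun hsub => ?_⟩
    have := hsub (Finset.mem_sdiff.2 ⟨hfS, hfT⟩)
    simp at this
  have hle : (S \ (Z ∪ insert f T)) ⊆ S \ (Z ∪ T) :=
    Finset.sdiff_subset_sdiff subset_rfl
      (Finset.union_subset_union subset_rfl (Finset.subset_insert _ _))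
  rcases hcase with ⟨-, hs'⟩ | ⟨hfC, o, hoC, x', hs'⟩
  · obtain ⟨n, hn, hw⟩ := ih _ hlt hs' rfl
    exact ⟨n, hn.trans (Finset.card_le_card hle), hw⟩
  · obtain ⟨n, hn, hw⟩ := ih _ hlt hs' rfl
    have hfZ : f ∉ Z := fun hf =>
      (hZ x (hs.flow.mono hs.sub) f hf).ne' (hs.flow.supp f.1 f.2 hfC)
    refine ⟨n + 1, ?_, .cons ⟨C, _, f, hs.tree, hs.sub, hs.flow, hs'.tree, hs'.sub, hs'.flow,
      Finset.insert_subset_insert _ (Finset.erase_subset _ _)⟩ hw⟩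
    refine Nat.lt_of_le_of_lt hn (Finset.card_lt_card ⟨hle, fun hsub => ?_⟩)
    have : f ∈ S \ (Z ∪ T) := by simp [hfS, hfZ, hfT]
    have := hsub this
    simp at this

/-- From any tree flow one reaches a flow that is positive on all edges of a spanning tree `S` with
at most one pivot for each edge of `S` that is not positive in all flows. -/
theorem exists_pivotWalk [Nonempty ι] (hS : IsSpanTree S) (hSE : S ⊆ E) (hg : IsFlow S u v g)
    (hpos : ∀ i j, (i, j) ∈ S → 0 < g i j) {Z : Finset (ι × κ)}
    (hZ : ∀ y, IsFlow E u v y → ∀ e ∈ Z, 0 < y e.1 e.2) (hC : IsSpanTree C) (hCE : C ⊆ E)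
    (hx : IsFlow C u v x) : ∃ n ≤ (S \ Z).card, PivotWalk E u v g x n := by
  obtain ⟨ρ⟩ := ‹Nonempty ι›
  obtain ⟨pd, h, hr⟩ := hS.exists_rooting ρ
  have hs : WalkState E S pd u v C ∅ x :=
    ⟨hC, hCE, hx, by simp, by simp, by simp, Sum.inl ρ, by simp⟩
  simpa using hs.exists_walk hr hg hSE hpos hZ

end Walk

/-! ### Circulations -/

section Circulations

variable {ι κ : Type*} [Fintype ι] [Fintype κ]

/-- The circulations on the edge set `B`: signed flows with zero margins. -/
def circ (B : Finset (ι × κ)) : Submodule ℝ (ι → κ → ℝ) where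
  carrier := {z | (∀ i, ∑ j, z i j = 0) ∧ (∀ j, ∑ i, z i j = 0) ∧ ∀ i j, (i, j) ∉ B → z i j = 0}
  zero_mem' := by simp
  add_mem' := by
    rintro a b ⟨h1, h2, h3⟩ ⟨k1, k2, k3⟩
    refine ⟨fun i => ?_, fun j => ?_, fun i j h => ?_⟩
    · simp [Finset.sum_add_distrib, h1, k1]
    · simp [Finset.sum_add_distrib, h2, k2]
    · simp [h3 i j h, k3 i j h]
  smul_mem' := by
    rintro c a ⟨h1, h2, h3⟩
    refine ⟨fun i => ?_, fun j => ?_, fun i j h => ?_⟩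
    · simp [← Finset.mul_sum, h1]
    · simp [← Finset.mul_sum, h2]
    · simp [h3 i j h]

theorem circ_mono {B B' : Finset (ι × κ)} (h : B ⊆ B') : circ B ≤ circ B' :=
  fun _ hz => ⟨hz.1, hz.2.1, fun i j hij => hz.2.2 i j fun h' => hij (h h')⟩

theorem IsCut.circ_eq_zero {E : Finset (ι × κ)} {e : ι × κ} {A : Set (ι ⊕ κ)} (hA : IsCut E e A)
    {z : ι → κ → ℝ} (hz : z ∈ circ E) : z e.1 e.2 = 0 := by
  rw [hA.flow_eq hz.2.2]
  simp [hz.1, hz.2.1]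

theorem Acyc.eq_zero {C : Finset (ι × κ)} (hC : Acyc C) {z : ι → κ → ℝ} (hz : z ∈ circ C) :
    z = 0 := by
  ext i j
  by_cases h : (i, j) ∈ C
  · obtain ⟨A, hA⟩ := hC _ h
    exact hA.circ_eq_zero hz
  · exact hz.2.2 i j h

variable [DecidableEq ι] [DecidableEq κ]

/-- The fundamental cycle of an edge outside a spanning tree. -/
theorem IsSpanTree.exists_cycle {C : Finset (ι × κ)} (hC : IsSpanTree C) {f : ι × κ} (hf : f ∉ C) :
    ∃ z ∈ circ (insert f C), z f.1 f.2 = 1 := by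
  obtain ⟨A, hA⟩ := hC.1.exists_cuts
  refine ⟨fun i j => (if i = f.1 ∧ j = f.2 then 1 else 0) -
    (treeFlow C A (Sum.inl f.1) (Sum.inr f.2) i j : ℝ), ⟨fun i => ?_, fun j => ?_, fun i j h => ?_⟩, ?_⟩
  · have h1 := treeFlow_row hC hA (Sum.inl f.1) (Sum.inr f.2) i
    rw [Finset.sum_sub_distrib, ← Int.cast_sum, h1]
    by_cases hi : f.1 = i
    · subst hi; simp
    · simp [hi, Ne.symm hi]
  · have h1 := treeFlow_col hC hA (Sum.inl f.1) (Sum.inr f.2) j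
    rw [Finset.sum_sub_distrib, ← Int.cast_sum, h1]
    by_cases hj : f.2 = j
    · subst hj; simp
    · simp [hj, Ne.symm hj]
  · simp only [Finset.mem_insert, not_or] at h
    have : ¬(i = f.1 ∧ j = f.2) := fun h' => h.1 (Prod.ext h'.1 h'.2)
    simp [this, treeFlow, h.2]
  · simp [treeFlow, hf]

omit [DecidableEq ι] [DecidableEq κ] in
theorem conn_univ [Nonempty ι] [Nonempty κ] : Conn (Finset.univ : Finset (ι × κ)) := by
  intro A hA p q hp
  have h : ∀ i j, Sum.inl i ∈ A ↔ Sum.inr j ∈ A := fun i j => by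
    simpa [Crosses] using hA (i, j) (Finset.mem_univ _)
  obtain ⟨i0⟩ := ‹Nonempty ι›
  obtain ⟨j0⟩ := ‹Nonempty κ›
  have h0 : Sum.inl i0 ∈ A := by
    rcases p with i | j
    · exact (h i0 j0).2 ((h i j0).1 hp)
    · exact (h i0 j).2 hp
  rcases q with i | j
  · exact (h i j0).2 ((h i0 j0).1 h0)
  · exact (h i0 j).1 h0

/-- `C` is a maximal acyclic subset of `B`: it is acyclic, and joins what `B` joins. -/
structure IsSpanForest (B C : Finset (ι × κ)) : Prop where
  sub : C ⊆ B
  acyc : Acyc C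
  max : ∀ A, (∀ e ∈ C, ¬Crosses A e) → ∀ e ∈ B, ¬Crosses A e

omit [Fintype ι] [Fintype κ] in
/-- The edges of a spanning tree that join different components of `B` are bridges, even in the
presence of all edges of `B`. -/
theorem IsSpanForest.isCut {B C D : Finset (ι × κ)} (hC : IsSpanForest B C) (hD : IsSpanTree D)
    (hCD : C ⊆ D) {e : ι × κ} (he : e ∈ D \ C) : ∃ A, IsCut (B ∪ D) e A := by
  rw [Finset.mem_sdiff] at he
  obtain ⟨A, hA⟩ := hD.1 e he.1
  refine ⟨A, hA.1, hA.2.1, fun e' he' hne => ?_⟩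
  rcases Finset.mem_union.1 he' with h | h
  · exact hC.max A (fun c hc => hA.2.2 c (hCD hc) fun h' => he.2 (h' ▸ hc)) e' h
  · exact hA.2.2 e' h hne

variable [Nonempty ι] [Nonempty κ]

theorem Acyc.exists_tree {N : Finset (ι × κ)} (hN : Acyc N) : ∃ C, N ⊆ C ∧ IsSpanTree C := by
  obtain ⟨C, h1, -, h2⟩ := hN.exists_spanTree (Finset.subset_univ _) conn_univ
  exact ⟨C, h1, h2⟩

/-- Circulations with prescribed values outside of a spanning forest. -/
theorem IsSpanForest.exists_circ {B C : Finset (ι × κ)} (hC : IsSpanForest B C) (c : ι → κ → ℝ) :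
    ∃ z ∈ circ B, ∀ e ∈ B \ C, z e.1 e.2 = c e.1 e.2 := by
  obtain ⟨D, hCD, hD⟩ := hC.acyc.exists_tree
  have hcyc : ∀ f ∈ B \ C, ∃ z ∈ circ (insert f C), z f.1 f.2 = 1 := by
    intro f hf
    have hfD : f ∉ D := fun h => by
      obtain ⟨A, hA⟩ := hD.1 f h
      rw [Finset.mem_sdiff] at hf
      exact hC.max A (fun c hc => hA.2.2 c (hCD hc) fun h' => hf.2 (h' ▸ hc)) f hf.1 hA.crosses
    obtain ⟨z, hz, hz1⟩ := hD.exists_cycle hfD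
    refine ⟨z, ⟨hz.1, hz.2.1, fun i j hij => ?_⟩, hz1⟩
    by_cases hijD : (i, j) ∈ D
    · obtain ⟨A, hA⟩ := hC.isCut hD hCD (e := (i, j)) (by
        simp only [Finset.mem_insert, not_or] at hij
        simp [hijD, hij.2])
      refine IsCut.circ_eq_zero (E := B ∪ D) hA (circ_mono ?_ hz)
      exact Finset.insert_subset (Finset.mem_union_left _ (Finset.mem_sdiff.1 hf).1)
        Finset.subset_union_right
    · refine hz.2.2 i j fun h => ?_
      rcases Finset.mem_insert.1 h with h | h
      · exact hij (h ▸ Finset.mem_insert_self _ _)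
      · exact hijD h
  choose! χ hχ hχ1 using hcyc
  refine ⟨∑ f ∈ B \ C, c f.1 f.2 • χ f, Submodule.sum_mem _ fun f hf => Submodule.smul_mem _ _
    (circ_mono (Finset.insert_subset (Finset.mem_sdiff.1 hf).1 hC.sub) (hχ f hf)), fun e he => ?_⟩
  simp only [Finset.sum_apply, Pi.smul_apply, smul_eq_mul]
  rw [Finset.sum_eq_single e]
  · simp [hχ1 e he]
  · intro f hf hne
    rw [(hχ f hf).2.2 e.1 e.2, mul_zero]
    have := (Finset.mem_sdiff.1 he).2
    simp [hne.symm, this]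
  · exact fun h => absurd he h

/-- The dimension of the space of circulations. -/
theorem IsSpanForest.finrank_circ {B C : Finset (ι × κ)} (hC : IsSpanForest B C) :
    Module.finrank ℝ (circ B) = (B \ C).card := by
  let φ : circ B →ₗ[ℝ] ((B \ C : Finset (ι × κ)) → ℝ) :=
    { toFun := fun z e => z.1 e.1.1 e.1.2
      map_add' := fun _ _ => rfl
      map_smul' := fun _ _ => rfl }
  have hinj : Function.Injective φ := by
    rw [injective_iff_map_eq_zero]
    rintro ⟨z, hz⟩ h0
    refine Subtype.ext (hC.acyc.eq_zero ⟨hz.1, hz.2.1, fun i j hij => ?_⟩)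
    by_cases hB : (i, j) ∈ B
    · exact congrFun h0 ⟨(i, j), by simp [hB, hij]⟩
    · exact hz.2.2 i j hB
  have hsurj : Function.Surjective φ := by
    intro c
    obtain ⟨z, hz, hz1⟩ := hC.exists_circ
      fun i j => if h : (i, j) ∈ B \ C then c ⟨(i, j), h⟩ else 0
    refine ⟨⟨z, hz⟩, funext fun e => ?_⟩
    exact (hz1 e.1 e.2).trans (dif_pos e.2)
  rw [(LinearEquiv.ofBijective φ ⟨hinj, hsurj⟩).finrank_eq, Module.finrank_fintype_fun_eq_card]
  exact Fintype.card_coe _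

omit [Fintype ι] [Fintype κ] [Nonempty ι] [Nonempty κ] in
theorem Acyc.exists_forest {N B : Finset (ι × κ)} (hN : Acyc N) (hNB : N ⊆ B) :
    ∃ C, N ⊆ C ∧ IsSpanForest B C := by
  obtain ⟨C, h1, h2, h3, h4⟩ := hN.exists_maximal hNB
  exact ⟨C, h1, h2, h3, h4⟩

omit [Fintype ι] [Fintype κ] [DecidableEq ι] [DecidableEq κ] [Nonempty ι] [Nonempty κ] in
theorem acyc_empty : Acyc (∅ : Finset (ι × κ)) := fun e he => absurd he (Finset.notMem_empty e)

/-- A set of edges without nonzero circulations is acyclic. -/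
theorem acyc_of_circ {B : Finset (ι × κ)} (h : ∀ z ∈ circ B, z = 0) : Acyc B := by
  obtain ⟨C, -, hC⟩ := (acyc_empty (ι := ι) (κ := κ)).exists_forest (Finset.empty_subset B)
  have : B \ C = ∅ := by
    rw [Finset.eq_empty_iff_forall_notMem]
    intro e he
    obtain ⟨z, hz, hz1⟩ := hC.exists_circ fun _ _ => 1
    have := hz1 e he
    simp [h z hz] at this
  exact hC.acyc.mono (Finset.sdiff_eq_empty_iff_subset.1 this)

omit [Nonempty ι] [Nonempty κ] in
theorem Acyc.finrank_insert_le {C : Finset (ι × κ)} (hC : Acyc C) (f : ι × κ) :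
    Module.finrank ℝ (circ (insert f C)) ≤ 1 := by
  let φ : circ (insert f C) →ₗ[ℝ] ℝ :=
    { toFun := fun z => z.1 f.1 f.2
      map_add' := fun _ _ => rfl
      map_smul' := fun _ _ => rfl }
  have hinj : Function.Injective φ := by
    rw [injective_iff_map_eq_zero]
    rintro ⟨z, hz⟩ h0
    refine Subtype.ext (hC.eq_zero ⟨hz.1, hz.2.1, fun i j hij => ?_⟩)
    by_cases hf : (i, j) = f
    · subst hf; exact h0
    · exact hz.2.2 i j (by simp [hf, hij])
  simpa using LinearMap.finrank_le_finrank_of_injective hinj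

omit [Fintype ι] [Fintype κ] [Nonempty ι] [Nonempty κ] in
theorem IsSpanTree.mem_of_isCut {E C : Finset (ι × κ)} (hC : IsSpanTree C) (hCE : C ⊆ E) {e : ι × κ}
    {A : Set (ι ⊕ κ)} (hA : IsCut E e A) : e ∈ C := by
  by_contra he
  exact hA.2.1 (hC.2 A (fun c hc => hA.2.2 c (hCE hc) fun h => he (h ▸ hc)) _ _ hA.1)

omit [Nonempty ι] [Nonempty κ] in
/-- Small steps keep positive entries positive. -/
theorem exists_pos_step {α : Type*} [Finite α] (y z : α → ℝ) :
    ∃ ε > 0, ∀ a, 0 < y a → 0 < y a + ε * z a := by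
  have : ∀ᶠ ε in nhdsWithin (0 : ℝ) (Set.Ioi 0), ∀ a, 0 < y a → 0 < y a + ε * z a := by
    rw [Filter.eventually_all]
    intro a
    by_cases ha : 0 < y a
    · have hc : ContinuousAt (fun ε : ℝ => y a + ε * z a) 0 := by fun_prop
      have := hc.eventually (lt_mem_nhds (a := 0) (by simpa using ha))
      exact (this.filter_mono nhdsWithin_le_nhds).mono fun ε h _ => h
    · exact Filter.Eventually.of_forall fun _ h => absurd h ha
  obtain ⟨ε, h, hε⟩ := (this.and self_mem_nhdsWithin).exists
  exact ⟨ε, hε, h⟩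

/-- Flows that are nonnegative outside of an acyclic set `N` can be moved, keeping the margins and
without entering new edges outside `N`, until the edges used, together with `N`, are acyclic. -/
theorem exists_acyc_supp {N : Finset (ι × κ)} (hN : Acyc N) (y : ι → κ → ℝ)
    (hy : ∀ i j, (i, j) ∉ N → 0 ≤ y i j) : ∃ x : ι → κ → ℝ, ∃ D, N ⊆ D ∧ Acyc D ∧
      (∀ i, ∑ j, x i j = ∑ j, y i j) ∧ (∀ j, ∑ i, x i j = ∑ i, y i j) ∧
      (∀ i j, (i, j) ∉ N → 0 ≤ x i j) ∧ (∀ i j, (i, j) ∉ D → x i j = 0) ∧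
      ∀ e ∈ D, e ∉ N → y e.1 e.2 ≠ 0 := by
  classical
  generalize hm : (Finset.univ.filter fun e : ι × κ => y e.1 e.2 ≠ 0 ∧ e ∉ N).card = m
  induction m using Nat.strong_induction_on generalizing y with
  | _ m ih =>
  set D := N ∪ Finset.univ.filter fun e : ι × κ => y e.1 e.2 ≠ 0 ∧ e ∉ N with hD
  by_cases hz : ∀ z ∈ circ D, z = 0
  · refine ⟨y, D, Finset.subset_union_left, acyc_of_circ hz, fun _ => rfl, fun _ => rfl, hy,
      fun i j hij => ?_, fun e he heN => ?_⟩
    · by_contra h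
      refine hij (Finset.mem_union.2 ?_)
      by_cases hN' : (i, j) ∈ N
      · exact Or.inl hN'
      · exact Or.inr (Finset.mem_filter.2 ⟨Finset.mem_univ _, h, hN'⟩)
    · rcases Finset.mem_union.1 he with h | h
      · exact absurd h heN
      · exact (Finset.mem_filter.1 h).2.1
  push Not at hz
  obtain ⟨z, hz, hz0⟩ := hz
  obtain ⟨z, hz, e, heN, he⟩ : ∃ z ∈ circ D, ∃ e, e ∉ N ∧ z e.1 e.2 < 0 := by
    refine Classical.byContradiction fun hcon => ?_
    push Not at hcon
    refine hz0 (hN.eq_zero ⟨hz.1, hz.2.1, fun i j hij => le_antisymm ?_ (hcon z hz (i, j) hij)⟩)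
    simpa using hcon (-z) (Submodule.neg_mem _ hz) (i, j) hij
  obtain ⟨o, ho, hmin⟩ := (Finset.univ.filter fun e : ι × κ => e ∉ N ∧ z e.1 e.2 < 0).exists_min_image
    (fun e => y e.1 e.2 / -z e.1 e.2) ⟨e, by simp [heN, he]⟩
  simp only [Finset.mem_filter, Finset.mem_univ, true_and] at ho hmin
  set t := y o.1 o.2 / -z o.1 o.2 with ht
  have ht0 : 0 ≤ t := div_nonneg (hy _ _ ho.1) (by linarith [ho.2])
  have hzy : ∀ e : ι × κ, e ∉ N → y e.1 e.2 = 0 → z e.1 e.2 = 0 := fun e heN h =>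
    hz.2.2 _ _ (by simp [hD, heN, h])
  set y' : ι → κ → ℝ := fun i j => y i j + t * z i j with hy'
  have hyo : y' o.1 o.2 = 0 := by
    have := ho.2.ne
    simp only [hy', ht]; field_simp; ring
  have hcard : (Finset.univ.filter fun e : ι × κ => y' e.1 e.2 ≠ 0 ∧ e ∉ N).card < m := by
    rw [← hm]
    refine Finset.card_lt_card ⟨fun e he => ?_, fun hsub => ?_⟩
    · simp only [Finset.mem_filter, Finset.mem_univ, true_and] at he ⊢
      refine ⟨fun h => he.1 ?_, he.2⟩
      simp only [hy', h, hzy e he.2 h]; simp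
    · have hmem : o ∈ Finset.univ.filter fun e : ι × κ => y e.1 e.2 ≠ 0 ∧ e ∉ N :=
        Finset.mem_filter.2 ⟨Finset.mem_univ _, fun h => ho.2.ne (hzy o ho.1 h), ho.1⟩
      exact (Finset.mem_filter.1 (hsub hmem)).2.1 hyo
  have hnn : ∀ i j, (i, j) ∉ N → 0 ≤ y' i j := by
    intro i j hij
    by_cases h : z i j < 0
    · have := hmin (i, j) ⟨hij, h⟩
      rw [le_div_iff₀ (by simpa using h)] at this
      simp only [hy']; linarith
    · exact add_nonneg (hy i j hij) (mul_nonneg ht0 (not_lt.1 h))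
  obtain ⟨x, D', h1, h2, h3, h4, h5, h6, h7⟩ := ih _ hcard y' hnn rfl
  refine ⟨x, D', h1, h2, fun i => ?_, fun j => ?_, h5, h6, fun e he heN h => h7 e he heN ?_⟩
  · rw [h3]; simp [hy', Finset.sum_add_distrib, ← Finset.mul_sum, hz.1]
  · rw [h4]; simp [hy', Finset.sum_add_distrib, ← Finset.mul_sum, hz.2.1]
  · simp only [hy', h, hzy e heN h]; simp

end Circulations

/-! ### Faces of flow polytopes -/

section Faces

variable {ι κ : Type*} [Fintype ι] [Fintype κ]
variable {B : Finset (ι × κ)} {u : ι → ℝ} {v : κ → ℝ}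

/-- The polytope of the nonnegative real flows with margins `u` and `v` on the edge set `B`. These
are exactly the nonempty faces of transportation polytopes, see `IsPolytopeFace.exists_flowPoly`. -/
def flowPoly (B : Finset (ι × κ)) (u : ι → ℝ) (v : κ → ℝ) : Set (ι → κ → ℝ) :=
  {y | IsFlow B u v y}

theorem IsFlow.sub_mem {C : Finset (ι × κ)} {x y : ι → κ → ℝ} (hx : IsFlow C u v x)
    (hy : IsFlow C u v y) : x - y ∈ circ C := by
  refine ⟨fun i => ?_, fun j => ?_, fun i j h => ?_⟩
  · simp [Finset.sum_sub_distrib, hx.row, hy.row]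
  · simp [Finset.sum_sub_distrib, hx.col, hy.col]
  · simp [hx.supp i j h, hy.supp i j h]

/-- A small step along a circulation, starting from a flow that is positive wherever the
circulation is nonzero, leads to a flow. -/
theorem IsFlow.exists_add {y z : ι → κ → ℝ} (hy : IsFlow B u v y) (hz : z ∈ circ B)
    (hpos : ∀ e ∈ B, z e.1 e.2 ≠ 0 → 0 < y e.1 e.2) :
    ∃ ε > (0 : ℝ), IsFlow B u v (y + ε • z) := by
  obtain ⟨ε, hε, h⟩ := exists_pos_step (fun e : ι × κ => y e.1 e.2) (fun e => z e.1 e.2)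
  refine ⟨ε, hε, fun i => ?_, fun j => ?_, fun i j => ?_, fun i j hij => ?_⟩
  · simp [Finset.sum_add_distrib, ← Finset.mul_sum, hy.row, hz.1]
  · simp [Finset.sum_add_distrib, ← Finset.mul_sum, hy.col, hz.2.1]
  · by_cases h0 : z i j = 0
    · simpa [h0] using hy.nonneg i j
    · have hB : (i, j) ∈ B := by
        by_contra hB
        exact h0 (hz.2.2 i j hB)
      exact (h (i, j) (hpos (i, j) hB h0)).le
  · simp [hy.supp i j hij, hz.2.2 i j hij]

theorem flowPoly_face {B' : Finset (ι × κ)} (hB : B' ⊆ B) (hne : (flowPoly B' u v).Nonempty) :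
    IsPolytopeFace (flowPoly B u v) (flowPoly B' u v) := by
  classical
  refine ⟨hne, fun _ => ⟨-∑ e ∈ B \ B', (ContinuousLinearMap.proj (R := ℝ) e.2).comp
    (ContinuousLinearMap.proj (R := ℝ) (φ := fun _ : ι => κ → ℝ) e.1), ?_⟩⟩
  have hl : ∀ y : ι → κ → ℝ, (-∑ e ∈ B \ B', (ContinuousLinearMap.proj (R := ℝ) e.2).comp
    (ContinuousLinearMap.proj (R := ℝ) (φ := fun _ : ι => κ → ℝ) e.1)) y =
      -∑ e ∈ B \ B', y e.1 e.2 := by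
    intro y
    simp
  ext x
  simp only [hl, neg_le_neg_iff, flowPoly, Set.mem_ofPred_eq]
  constructor
  · intro hx
    refine ⟨hx.mono hB, fun y hy => ?_⟩
    rw [Finset.sum_eq_zero fun e he => hx.supp e.1 e.2 (Finset.mem_sdiff.1 he).2]
    exact Finset.sum_nonneg fun e _ => hy.nonneg _ _
  · rintro ⟨hx, hmax⟩
    refine ⟨hx.row, hx.col, hx.nonneg, fun i j hij => ?_⟩
    by_cases hijB : (i, j) ∈ B
    · obtain ⟨y, hy⟩ := hne
      have h1 := hmax y (hy.mono hB)
      rw [Finset.sum_eq_zero (f := fun e : ι × κ => y e.1 e.2)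
        fun e he => hy.supp e.1 e.2 (Finset.mem_sdiff.1 he).2] at h1
      have h2 := (Finset.sum_eq_zero_iff_of_nonneg fun e _ => hx.nonneg e.1 e.2).1
        (le_antisymm h1 (Finset.sum_nonneg fun e _ => hx.nonneg e.1 e.2))
      exact h2 (i, j) (Finset.mem_sdiff.2 ⟨hijB, hij⟩)
    · exact hx.supp i j hijB

/-- Every nonempty face of a flow polytope is the flow polytope of the edges that are used
somewhere on the face, and some point of the face uses all of these edges. -/
theorem IsPolytopeFace.exists_flowPoly {H : Set (ι → κ → ℝ)}
    (hH : IsPolytopeFace (flowPoly B u v) H) :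
    ∃ B' ⊆ B, H = flowPoly B' u v ∧ ∃ y ∈ H, ∀ e ∈ B', 0 < y e.1 e.2 := by
  classical
  obtain ⟨⟨x0, hx0⟩, hexp⟩ := hH
  obtain ⟨l, hl⟩ := hexp ⟨x0, hx0⟩
  set B' := B.filter fun e => ∃ y ∈ H, 0 < y e.1 e.2 with hB'
  have hmem : ∀ y, y ∈ H ↔ IsFlow B u v y ∧ ∀ z, IsFlow B u v z → l z ≤ l y := by
    intro y; rw [hl]; rfl
  have hpos : ∀ T : Finset (ι × κ), T ⊆ B' → ∃ y ∈ H, ∀ e ∈ T, 0 < y e.1 e.2 := by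
    intro T
    induction T using Finset.induction_on with
    | empty => exact fun _ => ⟨x0, hx0, by simp⟩
    | insert e T _ ih =>
      intro hT
      obtain ⟨y, hy, hyT⟩ := ih fun a ha => hT (Finset.mem_insert_of_mem ha)
      obtain ⟨y', hy', hye⟩ := (Finset.mem_filter.1 (hT (Finset.mem_insert_self e T))).2
      have hy1 := (hmem y).1 hy
      have hy2 := (hmem y').1 hy'
      refine ⟨(1 / 2 : ℝ) • y + (1 / 2 : ℝ) • y', (hmem _).2 ⟨⟨fun i => ?_, fun j => ?_,
        fun i j => ?_, fun i j hij => ?_⟩, fun z hz => ?_⟩, fun a ha => ?_⟩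
      · simp only [Pi.add_apply, Pi.smul_apply, smul_eq_mul, Finset.sum_add_distrib,
          ← Finset.mul_sum, hy1.1.row, hy2.1.row]
        ring
      · simp only [Pi.add_apply, Pi.smul_apply, smul_eq_mul, Finset.sum_add_distrib,
          ← Finset.mul_sum, hy1.1.col, hy2.1.col]
        ring
      · have := hy1.1.nonneg i j
        have := hy2.1.nonneg i j
        simp only [Pi.add_apply, Pi.smul_apply, smul_eq_mul]
        linarith
      · simp [hy1.1.supp i j hij, hy2.1.supp i j hij]
      · have := hy1.2 z hz
        have := hy2.2 z hz
        simp only [map_add, map_smul, smul_eq_mul]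
        linarith
      · have h1 := hy1.1.nonneg a.1 a.2
        have h2 := hy2.1.nonneg a.1 a.2
        simp only [Pi.add_apply, Pi.smul_apply, smul_eq_mul]
        rcases Finset.mem_insert.1 ha with rfl | ha
        · linarith
        · linarith [hyT a ha]
  obtain ⟨y, hy, hyB⟩ := hpos B' subset_rfl
  have hsupp : ∀ x ∈ H, IsFlow B' u v x := by
    intro x hx
    have hx1 := ((hmem x).1 hx).1
    refine ⟨hx1.row, hx1.col, hx1.nonneg, fun i j hij => ?_⟩
    by_cases hB : (i, j) ∈ B
    · by_contra h0
      exact hij (Finset.mem_filter.2 ⟨hB, x, hx, lt_of_le_of_ne (hx1.nonneg i j) (Ne.symm h0)⟩)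
    · exact hx1.supp i j hB
  refine ⟨B', Finset.filter_subset _ _, Set.Subset.antisymm hsupp fun x hx => ?_, y, hy, hyB⟩
  have hyF := hsupp y hy
  obtain ⟨ε, hε, h⟩ := hyF.exists_add (hyF.sub_mem hx) fun e he _ => hyB e he
  have h1 := ((hmem y).1 hy).2 _ (h.mono (Finset.filter_subset _ _))
  simp only [map_add, map_smul, map_sub, smul_eq_mul] at h1
  have h2 : l y ≤ l x := by nlinarith
  exact (hmem x).2 ⟨IsFlow.mono hx (Finset.filter_subset _ _),
    fun z hz => (((hmem y).1 hy).2 z hz).trans h2⟩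

theorem vectorSpan_flowPoly_le : vectorSpan ℝ (flowPoly B u v) ≤ circ B := by
  refine Submodule.span_le.2 ?_
  rintro _ ⟨x, hx, y, hy, rfl⟩
  exact IsFlow.sub_mem hx hy

/-- If all circulations on `B` are feasible directions at some point, the flow polytope has the
dimension of the space of circulations. -/
theorem polyDim_flowPoly {y : ι → κ → ℝ} (hy : IsFlow B u v y)
    (h : ∀ z ∈ circ B, ∃ ε > (0 : ℝ), IsFlow B u v (y + ε • z)) :
    polyDim (flowPoly B u v) = Module.finrank ℝ (circ B) := by
  have : vectorSpan ℝ (flowPoly B u v) = circ B := by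
    refine le_antisymm vectorSpan_flowPoly_le fun z hz => ?_
    obtain ⟨ε, hε, h⟩ := h z hz
    have : ε • z ∈ vectorSpan ℝ (flowPoly B u v) := by
      have := vsub_mem_vectorSpan ℝ (s := flowPoly B u v) h hy
      simpa using this
    have := Submodule.smul_mem _ ε⁻¹ this
    rwa [smul_smul, inv_mul_cancel₀ hε.ne', one_smul] at this
  rw [polyDim, this]

omit [Fintype ι] [Fintype κ] in
theorem mem_of_mem_polyVertices {P : Set (ι → κ → ℝ)} {y : ι → κ → ℝ} (hy : y ∈ polyVertices P) :
    y ∈ P := by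
  obtain ⟨hne, hexp⟩ := hy
  obtain ⟨l, hl⟩ := hexp hne
  exact (hl ▸ rfl : y ∈ {x ∈ P | ∀ y ∈ P, l y ≤ l x}).1

omit [Fintype ι] [Fintype κ] in
/-- A polytope contains no segment with a vertex in its relative interior. -/
theorem eq_zero_of_mem_polyVertices {P : Set (ι → κ → ℝ)} {y z : ι → κ → ℝ}
    (hy : y ∈ polyVertices P) {ε δ : ℝ} (hε : 0 < ε) (hδ : 0 < δ) (h1 : y + ε • z ∈ P)
    (h2 : y + δ • -z ∈ P) : z = 0 := by
  obtain ⟨hne, hexp⟩ := hy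
  obtain ⟨l, hl⟩ := hexp hne
  have hyl : ∀ w ∈ P, l w ≤ l y := (hl ▸ rfl : y ∈ {x ∈ P | ∀ y ∈ P, l y ≤ l x}).2
  have h3 := hyl _ h1
  have h4 := hyl _ h2
  simp only [map_add, map_smul, map_neg, smul_eq_mul] at h3 h4
  have h5 : y + ε • z ∈ ({y} : Set (ι → κ → ℝ)) := by
    rw [hl]
    refine ⟨h1, fun w hw => (hyl w hw).trans ?_⟩
    simp only [map_add, map_smul, smul_eq_mul]
    have : 0 ≤ l z := by nlinarith
    nlinarith
  have h6 : ε • z = 0 := by simpa using h5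
  exact (smul_eq_zero.1 h6).resolve_left hε.ne'

/-- A flow with acyclic support is a vertex, as it is the only flow on its support. -/
theorem IsFlow.mem_polyVertices {C : Finset (ι × κ)} {y : ι → κ → ℝ} (hy : IsFlow C u v y)
    (hC : Acyc C) (hCB : C ⊆ B) : y ∈ polyVertices (flowPoly B u v) := by
  have : {y} = flowPoly C u v := by
    ext x
    refine ⟨fun h => h ▸ hy, fun h => ?_⟩
    exact sub_eq_zero.1 (hC.eq_zero (IsFlow.sub_mem h hy))
  show IsPolytopeFace _ _
  rw [this]
  exact flowPoly_face hCB ⟨y, hy⟩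

variable [DecidableEq ι] [DecidableEq κ]

/-- Two vertices whose supports together contain at most one cycle are adjacent. -/
theorem polyGraph_adj {C : Finset (ι × κ)} (hC : Acyc C) {f : ι × κ}
    {x y : polyVertices (flowPoly B u v)} (hxy : x ≠ y) (hx : IsFlow (insert f C ∩ B) u v x.1)
    (hy : IsFlow (insert f C ∩ B) u v y.1) : (polyGraph (flowPoly B u v)).Adj x y := by
  refine ⟨hxy, _, flowPoly_face (B' := insert f C ∩ B) Finset.inter_subset_right ⟨_, hx⟩,
    le_antisymm ?_ ?_, hx, hy⟩
  · exact (Submodule.finrank_mono (vectorSpan_flowPoly_le.trans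
      (circ_mono Finset.inter_subset_left))).trans (hC.finrank_insert_le f)
  · rw [polyDim, Submodule.one_le_finrank_iff, Submodule.ne_bot_iff]
    exact ⟨_, vsub_mem_vectorSpan ℝ (s := flowPoly (insert f C ∩ B) u v) hx hy,
      fun h => hxy (Subtype.ext (sub_eq_zero.1 h))⟩

/-- The inequalities `0 ≤ z e` with `e ∈ E₀` imply all the other ones among the flows on `B`. -/
def Describes (B E₀ : Finset (ι × κ)) (u : ι → ℝ) (v : κ → ℝ) : Prop :=
  E₀ ⊆ B ∧ ∀ z : ι → κ → ℝ, (∀ i, ∑ j, z i j = u i) → (∀ j, ∑ i, z i j = v j) →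
    (∀ i j, (i, j) ∉ B → z i j = 0) → (∀ e ∈ E₀, 0 ≤ z e.1 e.2) → IsFlow B u v z

/-- A minimal set of inequalities describing a flow polytope. -/
def MinDescribes (B E₀ : Finset (ι × κ)) (u : ι → ℝ) (v : κ → ℝ) : Prop :=
  Describes B E₀ u v ∧ ∀ e ∈ E₀, ¬Describes B (E₀.erase e) u v

theorem exists_minDescribes (B : Finset (ι × κ)) (u : ι → ℝ) (v : κ → ℝ) :
    ∃ E₀, MinDescribes B E₀ u v := by
  classical
  obtain ⟨E₀, h0, hmin⟩ := (B.powerset.filter fun E₀ => Describes B E₀ u v).exists_min_image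
    Finset.card ⟨B, Finset.mem_filter.2 ⟨Finset.mem_powerset_self B, subset_rfl,
      fun z h1 h2 h3 h4 => ⟨h1, h2, fun i j => by
        by_cases h : (i, j) ∈ B
        · exact h4 _ h
        · exact (h3 i j h).ge, h3⟩⟩⟩
  refine ⟨E₀, (Finset.mem_filter.1 h0).2, fun e he hd => ?_⟩
  have := hmin _ (Finset.mem_filter.2 ⟨Finset.mem_powerset.2 hd.1, hd⟩)
  have := Finset.card_erase_lt_of_mem he
  omega

variable {E₀ : Finset (ι × κ)} {y : ι → κ → ℝ}

omit [DecidableEq ι] [DecidableEq κ] in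
/-- A circulation is a feasible direction at a flow that is positive on the describing edges where
the circulation is nonzero; redundant edges need not be considered. -/
theorem Describes.exists_add (hE : Describes B E₀ u v) (hy : IsFlow B u v y) {z : ι → κ → ℝ}
    (hz : z ∈ circ B) (hpos : ∀ e ∈ E₀, z e.1 e.2 ≠ 0 → 0 < y e.1 e.2) :
    ∃ ε > (0 : ℝ), IsFlow B u v (y + ε • z) := by
  obtain ⟨ε, hε, h⟩ := exists_pos_step (fun e : ι × κ => y e.1 e.2) (fun e => z e.1 e.2)
  refine ⟨ε, hε, hE.2 _ (fun i => ?_) (fun j => ?_) (fun i j hij => ?_) fun e he => ?_⟩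
  · simp [Finset.sum_add_distrib, ← Finset.mul_sum, hy.row, hz.1]
  · simp [Finset.sum_add_distrib, ← Finset.mul_sum, hy.col, hz.2.1]
  · simp [hy.supp i j hij, hz.2.2 i j hij]
  · by_cases h0 : z e.1 e.2 = 0
    · simpa [h0] using hy.nonneg e.1 e.2
    · exact (h e (hpos e he h0)).le

/-- For each inequality of a minimal description some flow satisfies it with equality, and the
other ones strictly. -/
theorem MinDescribes.exists_point (hE : MinDescribes B E₀ u v) (hy : IsFlow B u v y)
    (hpos : ∀ e ∈ B, 0 < y e.1 e.2) {e : ι × κ} (he : e ∈ E₀) :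
    ∃ w, IsFlow B u v w ∧ w e.1 e.2 = 0 ∧ ∀ e' ∈ E₀, e' ≠ e → 0 < w e'.1 e'.2 := by
  have h1 := hE.2 e he
  simp only [Describes, not_and, not_forall] at h1
  obtain ⟨z, hr, hc, hs, hn, hz⟩ := h1 ((Finset.erase_subset _ _).trans hE.1.1)
  have hze : z e.1 e.2 < 0 := by
    by_contra h0
    refine hz (hE.1.2 z hr hc hs fun e' he' => ?_)
    by_cases h : e' = e
    · exact h ▸ not_lt.1 h0
    · exact hn e' (Finset.mem_erase.2 ⟨h, he'⟩)
  have hye := hpos e (hE.1.1 he)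
  set t := y e.1 e.2 / (y e.1 e.2 - z e.1 e.2) with ht
  have hd : 0 < y e.1 e.2 - z e.1 e.2 := by linarith
  have ht0 : 0 < t := div_pos hye hd
  have ht1 : t < 1 := (div_lt_one hd).2 (by linarith)
  have hw0 : (1 - t) * y e.1 e.2 + t * z e.1 e.2 = 0 := by
    rw [ht]; field_simp; ring
  have hw : ∀ e' ∈ E₀, e' ≠ e → 0 < (1 - t) * y e'.1 e'.2 + t * z e'.1 e'.2 := by
    intro e' he' hne
    have h2 := mul_pos (sub_pos.2 ht1) (hpos e' (hE.1.1 he'))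
    have h3 := mul_nonneg ht0.le (hn e' (Finset.mem_erase.2 ⟨hne, he'⟩))
    linarith
  refine ⟨fun i j => (1 - t) * y i j + t * z i j, hE.1.2 _ (fun i => ?_) (fun j => ?_)
    (fun i j hij => ?_) fun e' he' => ?_, hw0, hw⟩
  · rw [Finset.sum_add_distrib, ← Finset.mul_sum, ← Finset.mul_sum, hy.row, hr]; ring
  · rw [Finset.sum_add_distrib, ← Finset.mul_sum, ← Finset.mul_sum, hy.col, hc]; ring
  · simp [hy.supp i j hij, hs i j hij]
  · by_cases h : e' = e
    · subst h; exact hw0.ge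
    · exact (hw e' he' h).le

/-- Deleting an edge that lies on a cycle lowers the dimension by one. -/
theorem finrank_circ_erase {e : ι × κ} {z : ι → κ → ℝ} (hz : z ∈ circ B) (hze : z e.1 e.2 ≠ 0) :
    Module.finrank ℝ (circ (B.erase e)) + 1 = Module.finrank ℝ (circ B) := by
  let φ : Module.Dual ℝ (circ B) :=
    { toFun := fun z => z.1 e.1 e.2
      map_add' := fun _ _ => rfl
      map_smul' := fun _ _ => rfl }
  have hφ : φ ≠ 0 := fun h => hze (LinearMap.congr_fun h ⟨z, hz⟩)
  rw [← Module.Dual.finrank_ker_add_one_of_ne_zero hφ]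
  congr 1
  have : LinearMap.ker φ = (circ (B.erase e)).comap (circ B).subtype := by
    ext ⟨w, hw⟩
    refine ⟨fun h => ⟨hw.1, hw.2.1, fun i j hij => ?_⟩, fun h => h.2.2 e.1 e.2 (by simp)⟩
    by_cases h' : (i, j) = e
    · subst h'; exact h
    · exact hw.2.2 i j fun hB => hij (Finset.mem_erase.2 ⟨h', hB⟩)
  rw [this]
  exact (Submodule.comapSubtypeEquivOfLe (circ_mono (Finset.erase_subset e B))).finrank_eq.symm

/-- The facets correspond to the inequalities of a minimal description. -/
theorem MinDescribes.hirschBound_eq (hE : MinDescribes B E₀ u v) (hy : IsFlow B u v y)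
    (hpos : ∀ e ∈ B, 0 < y e.1 e.2) :
    hirschBound (flowPoly B u v) = E₀.card - Module.finrank ℝ (circ B) := by
  have hdim : ∀ {B' : Finset (ι × κ)} {y : ι → κ → ℝ}, IsFlow B' u v y →
      (∀ e ∈ B', 0 < y e.1 e.2) → polyDim (flowPoly B' u v) = Module.finrank ℝ (circ B') :=
    fun hy hpos => polyDim_flowPoly hy fun z hz => hy.exists_add hz fun e he _ => hpos e he
  choose! w hw hwe hwpos using fun e (he : e ∈ E₀) => hE.exists_point hy hpos he
  have hwF : ∀ e ∈ E₀, IsFlow (B.erase e) u v (w e) := fun e he =>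
    ⟨(hw e he).row, (hw e he).col, (hw e he).nonneg, fun i j hij => by
      by_cases h : (i, j) = e
      · subst h; exact hwe _ he
      · exact (hw e he).supp i j fun hB => hij (Finset.mem_erase.2 ⟨h, hB⟩)⟩
  have hrank : ∀ e ∈ E₀, Module.finrank ℝ (circ (B.erase e)) + 1 = Module.finrank ℝ (circ B) :=
    fun e he => finrank_circ_erase (hy.sub_mem (hw e he)) (by
      simpa [hwe e he] using (hpos e (hE.1.1 he)).ne')
  have hfac : polyFacets (flowPoly B u v) = (fun e => flowPoly (B.erase e) u v) '' E₀ := by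
    ext H
    constructor
    · rintro ⟨hH, hHd⟩
      obtain ⟨B', hB', rfl, x, hx, hxpos⟩ := hH.exists_flowPoly
      have hxB := IsFlow.mono hx hB'
      rw [hdim hy hpos, hdim hx hxpos] at hHd
      -- a facet on which all describing edges are used would have full dimension
      by_cases hsub : E₀ ⊆ B'
      · have : circ B = circ B' := by
          refine le_antisymm (fun z hz => ⟨hz.1, hz.2.1, fun i j hij => ?_⟩) (circ_mono hB')
          have h0 := IsFlow.supp hx i j hij
          obtain ⟨ε, hε, h⟩ := hE.1.exists_add hxB hz fun e he _ => hxpos e (hsub he)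
          obtain ⟨δ, hδ, k⟩ := hE.1.exists_add hxB (Submodule.neg_mem _ hz)
            fun e he _ => hxpos e (hsub he)
          have h1 := h.nonneg i j
          have k1 := k.nonneg i j
          simp only [Pi.add_apply, Pi.smul_apply, Pi.neg_apply, smul_eq_mul, h0] at h1 k1
          exact le_antisymm (by nlinarith) (by nlinarith)
        rw [this] at hHd
        omega
      · obtain ⟨e, he, heB'⟩ := Finset.not_subset.1 hsub
        have hBe : B' ⊆ B.erase e := fun a ha =>
          Finset.mem_erase.2 ⟨fun h => heB' (h ▸ ha), hB' ha⟩
        refine ⟨e, he, ?_⟩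
        have heq : circ B' = circ (B.erase e) :=
          Submodule.eq_of_le_of_finrank_eq (circ_mono hBe) (by have := hrank e he; omega)
        refine Set.Subset.antisymm (fun x' hx' => ?_) fun x' hx' => IsFlow.mono hx' hBe
        refine ⟨hx'.row, hx'.col, hx'.nonneg, fun i j hij => ?_⟩
        have h1 : x' - x ∈ circ B' := by
          rw [heq]
          exact IsFlow.sub_mem hx' (IsFlow.mono hx hBe)
        have h2 := h1.2.2 i j hij
        have h3 := IsFlow.supp hx i j hij
        simp only [Pi.sub_apply, h3, sub_zero] at h2
        exact h2
    · rintro ⟨e, he, rfl⟩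
      refine ⟨flowPoly_face (Finset.erase_subset _ _) ⟨_, hwF e he⟩, ?_⟩
      rw [hdim hy hpos, ← hrank e he, polyDim_flowPoly (hwF e he) fun z hz => ?_]
      obtain ⟨ε, hε, h⟩ := hE.1.exists_add (hw e he) (circ_mono (Finset.erase_subset _ _) hz)
        fun e' he' h0 => hwpos e he e' he' fun h => h0 (hz.2.2 _ _ (by simp [h]))
      refine ⟨ε, hε, h.row, h.col, h.nonneg, fun i j hij => ?_⟩
      simp [hz.2.2 i j hij, (hwF e he).supp i j hij]
  have hinj : Set.InjOn (fun e => flowPoly (B.erase e) u v) E₀ := by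
    intro e he e' he' h
    by_contra hne
    have h1 : w e ∈ flowPoly (B.erase e') u v := by
      have h2 : w e ∈ flowPoly (B.erase e) u v := hwF e he
      exact (show flowPoly (B.erase e) u v = flowPoly (B.erase e') u v from h) ▸ h2
    have h3 := IsFlow.supp h1 e'.1 e'.2 (by simp)
    exact (hwpos e he e' he' fun h => hne h.symm).ne' h3
  rw [hirschBound, hfac, hinj.ncard_image, Set.ncard_coe_finset, hdim hy hpos]

end Faces

/-! ### Short walks on flow polytopes -/

section Diameter

variable {ι κ : Type*} [Fintype ι] [Fintype κ] [DecidableEq ι] [DecidableEq κ]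
variable {B E₀ : Finset (ι × κ)} {u : ι → ℝ} {v : κ → ℝ} {y : ι → κ → ℝ}

theorem lex_nonneg {a b : ℝ} (ha : 0 ≤ a) (hb : a = 0 → 0 ≤ b) : 0 ≤ toLex (a, b) := by
  rw [Prod.Lex.le_iff]
  rcases ha.lt_or_eq with h | h
  · exact Or.inl h
  · exact Or.inr ⟨h, hb h.symm⟩

theorem lex_pos {a b : ℝ} (ha : 0 ≤ a) (hb : a = 0 → 0 < b) : 0 < toLex (a, b) := by
  rw [Prod.Lex.lt_iff]
  rcases ha.lt_or_eq with h | h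
  · exact Or.inl h
  · exact Or.inr ⟨h, hb h.symm⟩

theorem sum_toLex {α : Type*} (s : Finset α) (a b : α → ℝ) :
    ∑ k ∈ s, toLex (a k, b k) = toLex (∑ k ∈ s, a k, ∑ k ∈ s, b k) := by
  classical
  induction s using Finset.induction_on with
  | empty => simp; rfl
  | insert k s hk ih => rw [Finset.sum_insert hk, Finset.sum_insert hk, Finset.sum_insert hk, ih]; rfl

theorem fst_sum_lex {α : Type*} (s : Finset α) (x : α → ℝ ×ₗ ℝ) :
    (ofLex (∑ k ∈ s, x k)).1 = ∑ k ∈ s, (ofLex (x k)).1 := by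
  classical
  induction s using Finset.induction_on with
  | empty => simp
  | insert k s hk ih => rw [Finset.sum_insert hk, Finset.sum_insert hk, ← ih]; rfl

variable [Nonempty ι] [Nonempty κ]

/-- The edges used by a vertex are acyclic, even together with all redundant edges. -/
theorem Describes.acyc_vertex (hE : Describes B E₀ u v) (hy : y ∈ polyVertices (flowPoly B u v)) :
    Acyc ((Finset.univ.filter fun e : ι × κ => y e.1 e.2 ≠ 0) ∪ (B \ E₀)) := by
  have hyF : IsFlow B u v y := mem_of_mem_polyVertices hy
  have hsub : (Finset.univ.filter fun e : ι × κ => y e.1 e.2 ≠ 0) ∪ (B \ E₀) ⊆ B := by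
    refine Finset.union_subset (fun e he => ?_) Finset.sdiff_subset
    by_contra h
    exact (Finset.mem_filter.1 he).2 (hyF.supp e.1 e.2 h)
  have key : ∀ z ∈ circ ((Finset.univ.filter fun e : ι × κ => y e.1 e.2 ≠ 0) ∪ (B \ E₀)),
      ∃ ε > (0 : ℝ), IsFlow B u v (y + ε • z) := by
    intro z hz
    refine hE.exists_add hyF (circ_mono hsub hz) fun e he h0 => ?_
    refine lt_of_le_of_ne (hyF.nonneg _ _) fun h => h0 (hz.2.2 e.1 e.2 ?_)
    simp [← h, he]
  refine acyc_of_circ fun z hz => ?_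
  obtain ⟨ε, hε, h1⟩ := key z hz
  obtain ⟨δ, hδ, h2⟩ := key (-z) (Submodule.neg_mem _ hz)
  exact eq_zero_of_mem_polyVertices hy hε hδ h1 h2

/-- The support of any flow contains the support of a vertex. -/
theorem IsFlow.exists_vertex (hy : IsFlow B u v y) :
    ∃ x ∈ polyVertices (flowPoly B u v), ∀ i j, y i j = 0 → x i j = 0 := by
  obtain ⟨x, D, -, h2, h3, h4, h5, h6, h7⟩ := exists_acyc_supp acyc_empty y
    fun i j _ => hy.nonneg i j
  have h7' : ∀ e ∈ D, y e.1 e.2 ≠ 0 := fun e he => h7 e he (Finset.notMem_empty e)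
  have hD : D ⊆ B := fun e he => by
    by_contra h
    exact h7' e he (hy.supp e.1 e.2 h)
  refine ⟨x, IsFlow.mem_polyVertices (C := D) ⟨fun i => (h3 i).trans (hy.row i),
    fun j => (h4 j).trans (hy.col j), fun i j => h5 i j (Finset.notMem_empty _), h6⟩ h2 hD, ?_⟩
  exact fun i j h => h6 i j fun hmem => h7' (i, j) hmem h

/-- The redundant edges `B \ E₀` are acyclic. -/
theorem Describes.acyc_sdiff (hE : Describes B E₀ u v) (hy : IsFlow B u v y) :
    Acyc (B \ E₀) := by
  obtain ⟨x, hx, -⟩ := hy.exists_vertex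
  exact (hE.acyc_vertex hx).mono Finset.subset_union_right

/-- Forgets the infinitesimal part of a perturbed flow, and removes the unit of flow that was added
to each edge of `R`. -/
def unperturb (R : Finset (ι × κ)) (x : ι → κ → ℝ ×ₗ ℝ) (i : ι) (j : κ) : ℝ :=
  (ofLex (x i j)).1 - if (i, j) ∈ R then 1 else 0

omit [Nonempty ι] [Nonempty κ] in
/-- Perturbed tree flows project to vertices, and consecutive ones to equal or adjacent vertices. -/
theorem edist_le_of_pivotWalk {E R : Finset (ι × κ)} {U : ι → ℝ ×ₗ ℝ} {V : κ → ℝ ×ₗ ℝ}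
    {g : ι → κ → ℝ ×ₗ ℝ}
    (hproj : ∀ C ⊆ E, ∀ x, IsFlow C U V x → IsFlow (C ∩ B) u v (unperturb R x))
    {q : polyVertices (flowPoly B u v)} (hq : q.1 = unperturb R g) {x : ι → κ → ℝ ×ₗ ℝ} {n : ℕ}
    (h : PivotWalk E U V g x n) :
    ∀ p : polyVertices (flowPoly B u v), p.1 = unperturb R x →
      (polyGraph (flowPoly B u v)).edist p q ≤ n := by
  induction h with
  | nil =>
    intro p hp
    rw [Subtype.ext (hp.trans hq.symm : p.1 = q.1), SimpleGraph.edist_self]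
    exact zero_le
  | @cons x x' n hstep _ ih =>
    intro p hp
    obtain ⟨C, D, f, hC, hCE, hx, hD, hDE, hx', hDC⟩ := hstep
    have hpF := hproj C hCE x hx
    have hqF := hproj D hDE x' hx'
    let p' : polyVertices (flowPoly B u v) :=
      ⟨_, hqF.mem_polyVertices (hD.1.mono Finset.inter_subset_left) Finset.inter_subset_right⟩
    have h1 : (polyGraph (flowPoly B u v)).edist p p' ≤ 1 := by
      by_cases hpp : p = p'
      · rw [hpp, SimpleGraph.edist_self]; exact zero_le
      · have hadj := polyGraph_adj hC.1 (f := f) hpp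
          (by rw [hp]; exact hpF.mono (Finset.inter_subset_inter (Finset.subset_insert _ _) subset_rfl))
          (hqF.mono (Finset.inter_subset_inter hDC subset_rfl))
        simpa using hadj.toWalk.edist_le
    calc _ ≤ _ := SimpleGraph.edist_triangle (v := p')
      _ ≤ 1 + n := add_le_add h1 (ih p' rfl)
      _ = _ := by push_cast; rw [add_comm]

/-- Any two vertices of a flow polytope are joined by a walk with at most one step for each edge of
a spanning forest `C ⊇ B \ E₀` that is not redundant. -/
theorem Describes.edist_le (hE : Describes B E₀ u v) {C : Finset (ι × κ)} (hC : IsSpanForest B C)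
    (hRC : B \ E₀ ⊆ C) (p q : polyVertices (flowPoly B u v)) :
    (polyGraph (flowPoly B u v)).edist p q ≤ (C \ (B \ E₀)).card := by
  obtain ⟨D, hCD, hD⟩ := hC.acyc.exists_tree
  set R := B \ E₀ with hR
  set N : (ι → κ → ℝ) → Finset (ι × κ) :=
    fun x => (Finset.univ.filter fun e : ι × κ => x e.1 e.2 ≠ 0) ∪ R with hN
  have hNmem : ∀ x : ι → κ → ℝ, ∀ i j, (i, j) ∉ N x → x i j = 0 ∧ (i, j) ∉ R := by
    intro x i j h
    simpa [hN] using h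
  have hpF : IsFlow B u v p.1 := mem_of_mem_polyVertices p.2
  have hqF : IsFlow B u v q.1 := mem_of_mem_polyVertices q.2
  have hNE : ∀ x, IsFlow B u v x → N x ⊆ B ∪ D := by
    intro x hx
    refine Finset.union_subset (fun e he => ?_)
      (Finset.sdiff_subset.trans Finset.subset_union_left)
    by_contra h
    exact (Finset.mem_filter.1 he).2 (hx.supp e.1 e.2 fun h' => h (Finset.mem_union_left _ h'))
  have hconn : Conn (B ∪ D) := hD.2.mono Finset.subset_union_right
  obtain ⟨S, hNS, hSE, hS⟩ := (hE.acyc_vertex q.2).exists_spanTree (hNE _ hqF) hconn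
  have hNS' : N q.1 ⊆ S := hNS
  -- the target: the vertex `q`, shifted by one on `R`, and perturbed by an infinitesimal on `S`
  set ind : ι → κ → ℝ := fun i j => if (i, j) ∈ R then 1 else 0 with hind
  have hind0 : ∀ i j, 0 ≤ ind i j := fun i j => by simp only [hind]; split_ifs <;> norm_num
  set one : ι → κ → ℝ := fun i j => if (i, j) ∈ S then 1 else 0 with hone
  set g : ι → κ → ℝ ×ₗ ℝ := fun i j => toLex (q.1 i j + ind i j, one i j) with hg
  have hg0 : ∀ i j, 0 ≤ q.1 i j + ind i j := fun i j => add_nonneg (hqF.nonneg i j) (hind0 i j)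
  have hgF : IsFlow S (fun i => ∑ j, g i j) (fun j => ∑ i, g i j) g := by
    refine ⟨fun _ => rfl, fun _ => rfl, fun i j => lex_nonneg (hg0 i j) fun _ => ?_,
      fun i j hij => ?_⟩
    · simp only [hone]; split_ifs <;> norm_num
    · have h1 := hNmem q.1 i j fun h => hij (hNS' h)
      simp only [hg, hind, hone, h1.1, if_neg h1.2, if_neg hij, add_zero]
      rfl
  have hgpos : ∀ i j, (i, j) ∈ S → 0 < g i j := fun i j hij =>
    lex_pos (hg0 i j) fun _ => by simp [hone, hij]
  -- the edges of `D \ C` that join the components of `B` carry the same flow in all perturbed flows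
  have hbridge : ∀ x, IsFlow (B ∪ D) (fun i => ∑ j, g i j) (fun j => ∑ i, g i j) x →
      ∀ e ∈ D \ C, x e.1 e.2 = g e.1 e.2 := by
    intro x hx e he
    obtain ⟨A, hA⟩ := hC.isCut hD hCD he
    rw [hA.flow_eq hx.supp, hA.flow_eq (hgF.mono hSE).supp]
    simp only [hx.row, hx.col]
  have hDB : ∀ e ∈ D \ C, e ∉ B := by
    intro e he heB
    obtain ⟨A, hA⟩ := hC.isCut hD hCD he
    exact hC.max A (fun c hc => hA.2.2 c (Finset.mem_union_left _ (hC.sub hc))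
      fun h => (Finset.mem_sdiff.1 he).2 (h ▸ hc)) e heB hA.crosses
  have hproj' : ∀ x, IsFlow (B ∪ D) (fun i => ∑ j, g i j) (fun j => ∑ i, g i j) x →
      IsFlow B u v (unperturb R x) := by
    intro x hx
    refine hE.2 _ (fun i => ?_) (fun j => ?_) (fun i j hij => ?_) fun e he => ?_
    · simp only [unperturb]
      rw [Finset.sum_sub_distrib, ← fst_sum_lex, hx.row, fst_sum_lex]
      simp [hg, hind, Finset.sum_add_distrib, hqF.row]
    · simp only [unperturb]
      rw [Finset.sum_sub_distrib, ← fst_sum_lex, hx.col, fst_sum_lex]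
      simp [hg, hind, Finset.sum_add_distrib, hqF.col]
    · have hijR : (i, j) ∉ R := fun h => hij (Finset.mem_sdiff.1 h).1
      by_cases hijD : (i, j) ∈ D
      · have h1 := hbridge x hx (i, j) (Finset.mem_sdiff.2 ⟨hijD, fun h => hij (hC.sub h)⟩)
        simp only at h1
        simp [unperturb, h1, hg, hind, hijR, hqF.supp i j hij]
      · simp [unperturb, hijR, hx.supp i j (by simp [hij, hijD])]
    · have heR : (e.1, e.2) ∉ R := fun h => (Finset.mem_sdiff.1 h).2 he
      have := Prod.Lex.monotone_fst _ _ (hx.nonneg e.1 e.2)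
      simpa [unperturb, heR] using this
  have hproj : ∀ C' ⊆ B ∪ D, ∀ x, IsFlow C' (fun i => ∑ j, g i j) (fun j => ∑ i, g i j) x →
      IsFlow (C' ∩ B) u v (unperturb R x) := by
    intro C' hC' x hx
    have h := hproj' x (hx.mono hC')
    refine ⟨h.row, h.col, h.nonneg, fun i j hij => ?_⟩
    by_cases hB : (i, j) ∈ B
    · have h0 := hx.supp i j fun h' => hij (Finset.mem_inter.2 ⟨h', hB⟩)
      refine le_antisymm ?_ (h.nonneg i j)
      simpa [unperturb, h0, hind] using hind0 i j
    · exact h.supp i j hB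
  have hZ : ∀ x, IsFlow (B ∪ D) (fun i => ∑ j, g i j) (fun j => ∑ i, g i j) x →
      ∀ e ∈ R ∪ (D \ C), 0 < x e.1 e.2 := by
    intro x hx e he
    rcases Finset.mem_union.1 he with he | he
    · have h1 := (hproj' x hx).nonneg e.1 e.2
      simp only [unperturb, Prod.mk.eta, if_pos he] at h1
      exact lex_pos (a := (ofLex (x e.1 e.2)).1) (b := (ofLex (x e.1 e.2)).2) (by linarith)
        fun h => by linarith
    · rw [hbridge x hx e he]
      obtain ⟨A, hA⟩ := hC.isCut hD hCD he
      exact hgpos _ _ (hS.mem_of_isCut hSE hA)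
  -- the start: the vertex `p`, shifted alike, with an infinitesimal part of the same margins
  obtain ⟨x1, D0, hD0, hD0a, hr, hc, hnn, hs, hD0S⟩ := exists_acyc_supp (hE.acyc_vertex p.2) one
    fun i j _ => by simp only [hone]; split_ifs <;> norm_num
  have hD0' : N p.1 ⊆ D0 := hD0
  have hD0E : D0 ⊆ B ∪ D := by
    intro e he
    by_cases h : e ∈ N p.1
    · exact hNE _ hpF h
    · have := hD0S e he h
      simp only [hone, Prod.mk.eta, ne_eq, ite_eq_right_iff, one_ne_zero, imp_false, not_not] at this
      exact hSE this
  obtain ⟨C0, hDC0, hC0E, hC0⟩ := hD0a.exists_spanTree hD0E hconn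
  have hx0 : IsFlow C0 (fun i => ∑ j, g i j) (fun j => ∑ i, g i j)
      (fun i j => toLex (p.1 i j + ind i j, x1 i j)) := by
    refine ⟨fun i => ?_, fun j => ?_, fun i j => lex_nonneg
      (add_nonneg (hpF.nonneg i j) (hind0 i j)) fun h => hnn i j fun hmem => ?_, fun i j hij => ?_⟩
    · simp only [hg, sum_toLex, Finset.sum_add_distrib, hpF.row, hqF.row, hr]
    · simp only [hg, sum_toLex, Finset.sum_add_distrib, hpF.col, hqF.col, hc]
    · have h1 := hpF.nonneg i j
      have h2 := hind0 i j
      rcases Finset.mem_union.1 hmem with h' | h'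
      · exact (Finset.mem_filter.1 h').2 (by simp only; linarith)
      · have : ind i j = 1 := if_pos h'
        linarith
    · have h1 := hNmem p.1 i j fun h => hij (hDC0 (hD0' h))
      simp only [hind, h1.1, if_neg h1.2, hs i j fun h => hij (hDC0 h), add_zero]
      rfl
  obtain ⟨n, hn, hw⟩ := exists_pivotWalk hS hSE hgF hgpos hZ hC0 hC0E hx0
  refine (edist_le_of_pivotWalk hproj (q := q) ?_ hw p ?_).trans ?_
  · ext i j; simp [unperturb, hg, hind]
  · ext i j; simp [unperturb, hind]
  · have hZS : R ∪ (D \ C) ⊆ S := by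
      refine Finset.union_subset (Finset.subset_union_right.trans hNS') fun e he => ?_
      obtain ⟨A, hA⟩ := hC.isCut hD hCD he
      exact hS.mem_of_isCut hSE hA
    have hdisj : Disjoint R (D \ C) := Finset.disjoint_left.2 fun e he he' =>
      (Finset.mem_sdiff.1 he').2 (hRC he)
    have h1 := Finset.card_sdiff_add_card_eq_card hZS
    rw [Finset.card_union_of_disjoint hdisj] at h1
    have h2 := Finset.card_sdiff_add_card_eq_card hCD
    have h3 := Finset.card_sdiff_add_card_eq_card hRC
    have h4 := hS.card
    have h5 := hD.card
    exact_mod_cast (by omega : n ≤ (C \ R).card)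

theorem combDiamLE_of_edist_le {E : Type*} [AddCommGroup E] [Module ℝ E] [TopologicalSpace E]
    {P : Set E} {K : ℕ} {b : ℤ} (h : ∀ p q, (polyGraph P).edist p q ≤ K) (hb : (K : ℤ) ≤ b) :
    CombDiamLE P b := by
  have h1 := SimpleGraph.ediam_le_of_edist_le h
  obtain ⟨D, hD⟩ := ENat.ne_top_iff_exists.1 (ne_top_of_le_ne_top (ENat.natCast_ne_top K) h1)
  rw [← hD] at h1
  have h2 : D ≤ K := by exact_mod_cast h1
  exact ⟨D, hD.symm, by omega⟩

/-- The Hirsch bound of a flow polytope, in terms of a spanning forest and the redundant edges. -/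
theorem MinDescribes.hirschBound_eq_card (hE : MinDescribes B E₀ u v) (hy : IsFlow B u v y)
    (hpos : ∀ e ∈ B, 0 < y e.1 e.2) {C : Finset (ι × κ)} (hC : IsSpanForest B C) :
    hirschBound (flowPoly B u v) = C.card - (B \ E₀).card := by
  rw [hE.hirschBound_eq hy hpos, hC.finrank_circ]
  have h1 := Finset.card_sdiff_add_card_eq_card hE.1.1
  have h2 := Finset.card_sdiff_add_card_eq_card hC.sub
  omega

omit [Nonempty ι] [Nonempty κ] in
/-- An edge that is used by all flows is redundant. -/
theorem MinDescribes.notMem_of_forall_pos (hE : MinDescribes B E₀ u v) (hy : IsFlow B u v y)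
    (hpos : ∀ e ∈ B, 0 < y e.1 e.2) {e : ι × κ} (he : ∀ x, IsFlow B u v x → 0 < x e.1 e.2) :
    e ∉ E₀ := fun h => by
  obtain ⟨w, hw, hw0, -⟩ := hE.exists_point hy hpos h
  exact (he w hw).ne' hw0

/-- If all vertices are nondegenerate, then only edges used by all flows are redundant: at a vertex
that avoids a redundant edge `e`, all other unused edges could be raised while `e` is lowered. -/
theorem Describes.pos_of_notMem (hE : Describes Finset.univ E₀ u v)
    (hnd : ∀ y ∈ polyVertices (flowPoly Finset.univ u v),
      (Finset.univ.filter fun e : ι × κ => y e.1 e.2 ≠ 0).card + 1 =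
        Fintype.card ι + Fintype.card κ)
    {e : ι × κ} (he : e ∉ E₀) (hy : IsFlow Finset.univ u v y) : 0 < y e.1 e.2 := by
  refine lt_of_le_of_ne (hy.nonneg _ _) fun h0 => ?_
  obtain ⟨x, hx, hxy⟩ := hy.exists_vertex
  have hxe := hxy _ _ h0.symm
  have hxF : IsFlow Finset.univ u v x := mem_of_mem_polyVertices hx
  set C := Finset.univ.filter fun e : ι × κ => x e.1 e.2 ≠ 0 with hCdef
  have hCa : Acyc C := (hE.acyc_vertex hx).mono Finset.subset_union_left
  obtain ⟨D, hCD, hD⟩ := hCa.exists_tree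
  have hCeq : C = D := Finset.eq_of_subset_of_card_le hCD (by
    have := hD.card
    have : C.card + 1 = Fintype.card ι + Fintype.card κ := hnd x hx
    omega)
  have hF : IsSpanForest Finset.univ C := ⟨Finset.subset_univ _, hCa, fun A hA e _ hcr =>
    hcr ⟨(hCeq ▸ hD).2 A hA _ _, (hCeq ▸ hD).2 A hA _ _⟩⟩
  obtain ⟨z, hz, hzc⟩ := hF.exists_circ fun i j => if (i, j) = e then -1 else 1
  obtain ⟨ε, hε, h⟩ := exists_pos_step (fun e : ι × κ => x e.1 e.2) (fun e => z e.1 e.2)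
  have hflow : IsFlow Finset.univ u v (x + ε • z) := by
    refine hE.2 _ (fun i => ?_) (fun j => ?_) (fun i j hij => absurd (Finset.mem_univ _) hij)
      fun f hf => ?_
    · simp [Finset.sum_add_distrib, ← Finset.mul_sum, hxF.row, hz.1]
    · simp [Finset.sum_add_distrib, ← Finset.mul_sum, hxF.col, hz.2.1]
    · by_cases hfC : f ∈ C
      · have := (Finset.mem_filter.1 hfC).2
        exact (h f (lt_of_le_of_ne (hxF.nonneg _ _) this.symm)).le
      · have h1 := hzc f (by simp [hfC])
        have h2 : f ≠ e := fun h => he (h ▸ hf)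
        have h3 : x f.1 f.2 = 0 := by simpa [hCdef] using hfC
        simp only [Prod.mk.eta, if_neg h2] at h1
        simp only [Pi.add_apply, Pi.smul_apply, smul_eq_mul, h1, h3]
        linarith
  have h1 := hflow.nonneg e.1 e.2
  have h2 := hzc e (by simp [hCdef, hxe])
  simp only [Prod.mk.eta, if_true] at h2
  simp only [Pi.add_apply, Pi.smul_apply, smul_eq_mul, hxe, h2] at h1
  linarith

end Diameter

/-! ### Transportation polytopes -/

theorem transportationPolytope_eq {N₁ N₂ : ℕ} (u : Fin N₁ → ℝ) (v : Fin N₂ → ℝ) :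
    transportationPolytope u v = flowPoly Finset.univ u v := by
  ext y
  exact ⟨fun h => ⟨h.1, h.2.1, h.2.2, fun i j hij => absurd (Finset.mem_univ _) hij⟩,
    fun h => ⟨h.row, h.col, h.nonneg⟩⟩

theorem theorem2 {N₁ N₂ : ℕ} (hN₁ : 0 < N₁) (hN₂ : 0 < N₂)
    (u : Fin N₁ → ℝ) (v : Fin N₂ → ℝ) (hu : ∀ i, 0 < u i) (hv : ∀ j, 0 < v j)
    (huv : ∑ i, u i = ∑ j, v j) :
    -- the diameter bound
    CombDiamLE (transportationPolytope u v)
      ((N₁ : ℤ) + (N₂ : ℤ) - 1 - ((criticalPairs u v).ncard : ℤ)) ∧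
    -- in the non-degenerate case this bound is exactly the Hirsch bound
    (IsNondegenerateTP u v →
      hirschBound (transportationPolytope u v) =
        (N₁ : ℤ) + (N₂ : ℤ) - 1 - ((criticalPairs u v).ncard : ℤ)) ∧
    -- the Hirsch conjecture for the transportation polytope
    SatisfiesHirsch (transportationPolytope u v) ∧
    -- both bounds for every face
    (∀ G : Set (Fin N₁ → Fin N₂ → ℝ), IsPolytopeFace (transportationPolytope u v) G →
      CombDiamLE G ((N₁ : ℤ) + (N₂ : ℤ) - 1 - ((criticalPairs u v).ncard : ℤ)) ∧
      SatisfiesHirsch G) := by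
  classical
  have : Nonempty (Fin N₁) := ⟨⟨0, hN₁⟩⟩
  have : Nonempty (Fin N₂) := ⟨⟨0, hN₂⟩⟩
  have hsum : 0 < ∑ i, u i := Finset.sum_pos (fun i _ => hu i) Finset.univ_nonempty
  -- the proportional flow uses all edges
  have hprop : IsFlow Finset.univ u v fun i j => u i * v j / ∑ i, u i := by
    refine ⟨fun i => ?_, fun j => ?_, fun i j => (div_pos (mul_pos (hu i) (hv j)) hsum).le,
      fun i j hij => absurd (Finset.mem_univ _) hij⟩
    · rw [← Finset.sum_div, ← Finset.mul_sum, ← huv, mul_div_cancel_right₀ _ hsum.ne']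
    · rw [← Finset.sum_div, ← Finset.sum_mul, mul_div_cancel_left₀ _ hsum.ne']
  have hprop0 : ∀ e ∈ (Finset.univ : Finset (Fin N₁ × Fin N₂)),
      0 < (fun i j => u i * v j / ∑ i, u i : Fin N₁ → Fin N₂ → ℝ) e.1 e.2 :=
    fun e _ => div_pos (mul_pos (hu _) (hv _)) hsum
  rw [transportationPolytope_eq]
  have hface : ∀ G : Set (Fin N₁ → Fin N₂ → ℝ), IsPolytopeFace (flowPoly Finset.univ u v) G →
      CombDiamLE G ((N₁ : ℤ) + (N₂ : ℤ) - 1 - ((criticalPairs u v).ncard : ℤ)) ∧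
      SatisfiesHirsch G := by
    intro G hG
    obtain ⟨B, -, rfl, y, hy, hpos⟩ := hG.exists_flowPoly
    obtain ⟨E₀, hE⟩ := exists_minDescribes B u v
    obtain ⟨C, hRC, hC⟩ := (hE.1.acyc_sdiff hy).exists_forest Finset.sdiff_subset
    have hdist := hE.1.edist_le hC hRC
    have h1 := Finset.card_sdiff_add_card_eq_card hRC
    refine ⟨combDiamLE_of_edist_le hdist ?_, combDiamLE_of_edist_le hdist ?_⟩
    · obtain ⟨D, hCD, hD⟩ := hC.acyc.exists_tree
      have h2 := Finset.card_le_card hCD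
      have h3 := hD.card
      have h4 : (criticalPairs u v).ncard ≤ (B \ E₀).card := by
        rw [← Set.ncard_coe_finset]
        refine Set.ncard_le_ncard (fun e he => ?_) (Finset.finite_toSet _)
        have he' : ∀ x, IsFlow B u v x → 0 < x e.1 e.2 := fun x hx =>
          he x ⟨hx.row, hx.col, hx.nonneg⟩
        refine Finset.mem_coe.2 (Finset.mem_sdiff.2 ⟨?_, hE.notMem_of_forall_pos hy hpos he'⟩)
        by_contra h
        exact (he' y hy).ne' (IsFlow.supp hy e.1 e.2 h)
      simp only [Fintype.card_fin] at h3
      omega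
    · rw [hE.hirschBound_eq_card hy hpos hC]
      omega
  have hTP := hface _ (flowPoly_face subset_rfl ⟨_, hprop⟩)
  refine ⟨hTP.1, fun hnd => ?_, hTP.2, hface⟩
  obtain ⟨E₀, hE⟩ := exists_minDescribes Finset.univ u v
  obtain ⟨C, -, hC⟩ := (acyc_empty (ι := Fin N₁) (κ := Fin N₂)).exists_tree
  have hF : IsSpanForest Finset.univ C := ⟨Finset.subset_univ _, hC.1, fun A hA e _ hcr =>
    hcr ⟨hC.2 A hA _ _, hC.2 A hA _ _⟩⟩
  rw [hE.hirschBound_eq_card hprop hprop0 hF]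
  have h1 := hC.card
  simp only [Fintype.card_fin] at h1
  have hcrit : criticalPairs u v = (Finset.univ \ E₀ : Finset (Fin N₁ × Fin N₂)) := by
    ext e
    constructor
    · intro he
      refine Finset.mem_coe.2 (Finset.mem_sdiff.2 ⟨Finset.mem_univ _,
        hE.notMem_of_forall_pos hprop hprop0 fun x hx => he x ⟨hx.row, hx.col, hx.nonneg⟩⟩)
    · intro he x hx
      rw [transportationPolytope_eq] at hx
      refine hE.1.pos_of_notMem (fun y hy => ?_) (Finset.mem_sdiff.1 (Finset.mem_coe.1 he)).2 hx
      have h2 := hnd y (by rwa [transportationPolytope_eq])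
      have h3 : {p : Fin N₁ × Fin N₂ | 0 < y p.1 p.2} =
          (Finset.univ.filter fun e : Fin N₁ × Fin N₂ => y e.1 e.2 ≠ 0 : Finset _) := by
        ext p
        have h4 := IsFlow.nonneg (mem_of_mem_polyVertices hy : IsFlow _ u v y) p.1 p.2
        simpa using h4.lt_iff_ne.trans ne_comm
      rw [h3, Set.ncard_coe_finset] at h2
      simp only [Fintype.card_fin]
      convert (by omega : (Finset.univ.filter fun e : Fin N₁ × Fin N₂ =>
        y e.1 e.2 ≠ 0).card + 1 = N₁ + N₂)
  rw [hcrit, Set.ncard_coe_finset]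
  omega
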